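/- Work over $\mathbb{C}$ and let $m,n\ge 0$. Let $\Lambda(n)$ be the Grassmann algebra on anticommuting indeterminates $\xi_1,\dots,\xi_n$ and let $\Lambda(m,n)=\Lambda(n)[[x_1,\dots,x_m]]$, a superalgebra with $x_i$ even and $\xi_j$ odd, with the topology in which the powers of the ideal $(x_1,\dots,x_m,\xi_1,\dots,\xi_n)$ form a fundamental system of neighbourhoods of $0$. Let $W(m,n)$ be the Lie superalgebra of all continuous derivations of the superalgebra $\Lambda(m,n)$; its elements are the sums $\sum_i P_i\frac{\partial}{\partial x_i}+\sum_j Q_j\frac{\partial}{\partial \xi_j}$ with $P_i,Q_j\in\Lambda(m,n)$, and it carries the product topology of $\Lambda(m,n)^{m+n}$. Put $W(m,n)_{-1}=\sum_i\mathbb{C}\frac{\partial}{\partial x_i}+\sum_j\mathbb{C}\frac{\partial}{\partial\xi_j}$; the projection $W(m,n)\to W(m,n)_{-1}$ replaces the coefficients $P_i,Q_j$ by their constant terms. A subalgebra of $W(m,n)$ is called transitive if its projection on $W(m,n)_{-1}$ is onto. For a subspace $U$ of $\sum_i\mathbb{C}x_i+\sum_j\mathbb{C}\xi_j$ let $I_U$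 be the ideal of $\Lambda(m,n)$ generated by $U$, and let $W_U=\{X\in W(m,n)\mid X I_U\subset I_U\}$. Let $L$ be a closed ($\mathbb{Z}/2$-graded) subalgebra of the Lie superalgebra $W(m,n)$, let $V$ be the projection of $L$ on $W(m,n)_{-1}$, and let $V^*=\{u\in\sum_i\mathbb{C}x_i+\sum_j\mathbb{C}\xi_j \mid \partial(u)=0 \text{ for all } \partial\in V\}$. (a) There exists a continuous (parity-preserving) automorphism $\varphi$ of $\Lambda(m,n)$, with continuous inverse, such that the induced automorphism $X\mapsto \varphi X\varphi^{-1}$ of $W(m,n)$ maps $L$ into $W_{V^*}$. (b) $\Lambda(m,n)$ has no closed $L$-invariant two-sided ideals other than $0$ and $\Lambda(m,n)$ if and only if $L$ is transitive. The same equivalence holds if only $\mathbb{Z}/2$-graded ideals are considered. -/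

import Mathlib

noncomputable section

namespace FormalSuper

/-- The Grassmann algebra `Λ(n)` over `ℂ` on `n` anticommuting indeterminates. -/
abbrev Grassmann (n : ℕ) : Type := ExteriorAlgebra ℂ (Fin n → ℂ)

/-- `Λ(m,n) = Λ(n)[[x₁, …, x_m]]`: formal power series in `m` (central) even indeterminates with
coefficients in the Grassmann algebra `Λ(n)`. -/
abbrev Lam (m n : ℕ) : Type := MvPowerSeries (Fin m) (Grassmann n)

variable {m n : ℕ}

/-- The even indeterminate `x_i`. -/
def evenVar (i : Fin m) : Lam m n := MvPowerSeries.X i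

/-- The odd indeterminate `ξ_j`. -/
def oddVar (j : Fin n) : Lam m n :=
  MvPowerSeries.C (ExteriorAlgebra.ι ℂ (Pi.single j (1 : ℂ)))

/-- All indeterminates `x₁, …, x_m, ξ₁, …, ξ_n`. -/
def gen : Fin m ⊕ Fin n → Lam m n := Sum.elim evenVar oddVar

/-- The subspace `Λ(m,n)_i` of even (`i = 0`) or odd (`i = 1`) elements. -/
def parity (i : ZMod 2) : Submodule ℂ (Lam m n) where
  carrier := {f | ∀ d, MvPowerSeries.coeff d f ∈
    CliffordAlgebra.evenOdd (0 : QuadraticForm ℂ (Fin n → ℂ)) i}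
  add_mem' := fun hf hg d => by
    rw [map_add]; exact Submodule.add_mem _ (hf d) (hg d)
  zero_mem' := fun d => by rw [map_zero]; exact Submodule.zero_mem _
  smul_mem' := fun c f hf d => Submodule.smul_mem _ c (hf d)

/-- The two-sided ideal `(x₁, …, x_m, ξ₁, …, ξ_n)` of `Λ(m,n)`, viewed as an `Ideal` in order to
have its powers. -/
def augIdeal (m n : ℕ) : Ideal (Lam m n) :=
  (TwoSidedIdeal.span (Set.range (gen : Fin m ⊕ Fin n → Lam m n))).asIdeal

instance : (augIdeal m n).IsTwoSided := by unfold augIdeal; infer_instance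

theorem augIdeal_pow_anti {j k : ℕ} (h : j ≤ k) : augIdeal m n ^ k ≤ augIdeal m n ^ j := by
  obtain ⟨l, rfl⟩ := Nat.exists_eq_add_of_le h
  rw [Ideal.IsTwoSided.pow_add]
  exact Ideal.mul_le_left

/-- The formal topology: the powers of `(x₁, …, x_m, ξ₁, …, ξ_n)` form a fundamental system of
neighbourhoods of `0`, and their translates by `f` one of neighbourhoods of `f`. -/
instance : TopologicalSpace (Lam m n) where
  IsOpen U := ∀ f ∈ U, ∃ k : ℕ, ∀ g, g - f ∈ augIdeal m n ^ k → g ∈ U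
  isOpen_univ := fun _ _ => ⟨0, fun _ _ => trivial⟩
  isOpen_inter := fun U V hU hV f hf => by
    obtain ⟨k, hk⟩ := hU f hf.1
    obtain ⟨l, hl⟩ := hV f hf.2
    exact ⟨max k l, fun g hg => ⟨hk g (augIdeal_pow_anti (le_max_left k l) hg),
      hl g (augIdeal_pow_anti (le_max_right k l) hg)⟩⟩
  isOpen_sUnion := fun S hS f hf => by
    obtain ⟨U, hU, hfU⟩ := hf
    obtain ⟨k, hk⟩ := hS U hU f hfU
    exact ⟨k, fun g hg => ⟨U, hU, hk g hg⟩⟩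

/-- The sign `(-1)^{p q}` of the rule of signs. -/
def sgn (p q : ZMod 2) : ℂ := (-1) ^ (p.val * q.val)

theorem sgn_zero_left (q : ZMod 2) : sgn 0 q = 1 := by
  rw [sgn, ZMod.val_zero, zero_mul, pow_zero]

theorem sgn_zero_right (p : ZMod 2) : sgn p 0 = 1 := by
  rw [sgn, ZMod.val_zero, mul_zero, pow_zero]

theorem sgn_one_one : sgn 1 1 = -1 := by
  rw [sgn, ZMod.val_one, one_mul, pow_one]

theorem zmod_two_cases (p : ZMod 2) : p = 0 ∨ p = 1 := by
  revert p; decide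

/-- `D` is a continuous derivation of parity `p` of the superalgebra `Λ(m,n)`:
`D (f g) = D(f) g + (-1)^{p i} f D(g)` for `f` of parity `i`. -/
structure IsSuperDer (p : ZMod 2) (D : Module.End ℂ (Lam m n)) : Prop where
  map_parity : ∀ i : ZMod 2, ∀ f ∈ parity (m := m) (n := n) i, D f ∈ parity (i + p)
  leibniz : ∀ i : ZMod 2, ∀ f ∈ parity (m := m) (n := n) i, ∀ g,
    D (f * g) = D f * g + sgn p i • (f * D g)
  continuous : Continuous D

/-! Continuity of a derivation is automatic; this gives the linear structure below. -/

/-- The parity automorphism of `Λ(m,n)`: it is `(-1)^i` on elements of parity `i`. -/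
def parityAut : Lam m n →+* Lam m n :=
  MvPowerSeries.map
    (CliffordAlgebra.involute (Q := (0 : QuadraticForm ℂ (Fin n → ℂ)))).toRingHom

theorem coeff_parityAut (f : Lam m n) (d : Fin m →₀ ℕ) :
    MvPowerSeries.coeff d (parityAut f) =
      CliffordAlgebra.involute (MvPowerSeries.coeff d f) :=
  MvPowerSeries.coeff_map _ _ _

theorem parityAut_of_mem {i : ZMod 2} {f : Lam m n} (hf : f ∈ parity i) :
    parityAut f = sgn 1 i • f := by
  ext d
  rw [coeff_parityAut]
  have h := hf d
  revert h
  generalize hc : MvPowerSeries.coeff d f = c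
  have hs : MvPowerSeries.coeff d (sgn 1 i • f) = sgn 1 i • c := by rw [← hc]; rfl
  rw [hs]
  rcases zmod_two_cases i with rfl | rfl
  · intro h
    rw [sgn_zero_right, one_smul]
    exact CliffordAlgebra.involute_eq_of_mem_even h
  · intro h
    rw [sgn_one_one, neg_one_smul]
    exact CliffordAlgebra.involute_eq_of_mem_odd h

theorem exists_even_add_odd (f : Lam m n) :
    ∃ f₀ ∈ parity (m := m) (n := n) 0, ∃ f₁ ∈ parity (m := m) (n := n) 1, f = f₀ + f₁ := by
  have h : ∀ d, ∃ a b : Grassmann n,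
      a ∈ CliffordAlgebra.evenOdd (0 : QuadraticForm ℂ (Fin n → ℂ)) 0 ∧
      b ∈ CliffordAlgebra.evenOdd (0 : QuadraticForm ℂ (Fin n → ℂ)) 1 ∧
      MvPowerSeries.coeff d f = a + b := fun d => by
    have := (CliffordAlgebra.evenOdd_isCompl
      (Q := (0 : QuadraticForm ℂ (Fin n → ℂ)))).sup_eq_top
    obtain ⟨a, ha, b, hb, e⟩ := Submodule.mem_sup.1
      (this ▸ Submodule.mem_top : MvPowerSeries.coeff d f ∈ _)
    exact ⟨a, b, ha, hb, e.symm⟩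
  choose a b ha hb e using h
  exact ⟨a, ha, b, hb, MvPowerSeries.ext e⟩

theorem gen_mem_parity (k : Fin m ⊕ Fin n) :
    (gen k : Lam m n) ∈ parity (m := m) (n := n) (Sum.elim (fun _ => 0) (fun _ => 1) k) := by
  classical
  intro d
  rcases k with i | j
  · simp only [gen, evenVar, Sum.elim_inl, MvPowerSeries.coeff_X]
    split_ifs
    · exact CliffordAlgebra.one_le_evenOdd_zero _ (Submodule.mem_one.2 ⟨1, map_one _⟩)
    · exact Submodule.zero_mem _
  · simp only [gen, oddVar, Sum.elim_inr, MvPowerSeries.coeff_C]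
    split_ifs
    · exact CliffordAlgebra.ι_mem_evenOdd_one _ _
    · exact Submodule.zero_mem _

theorem gen_mem_augIdeal (k : Fin m ⊕ Fin n) : (gen k : Lam m n) ∈ augIdeal m n :=
  TwoSidedIdeal.mem_asIdeal.2 (TwoSidedIdeal.subset_span ⟨k, rfl⟩)

theorem parityAut_mem_augIdeal {f : Lam m n} (hf : f ∈ augIdeal m n) :
    parityAut f ∈ augIdeal m n := by
  have h : TwoSidedIdeal.span (Set.range (gen : Fin m ⊕ Fin n → Lam m n)) ≤
      TwoSidedIdeal.comap parityAut
        (TwoSidedIdeal.span (Set.range (gen : Fin m ⊕ Fin n → Lam m n))) := by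
    rw [TwoSidedIdeal.span_le]
    rintro _ ⟨k, rfl⟩
    rw [SetLike.mem_coe, TwoSidedIdeal.mem_comap, parityAut_of_mem (gen_mem_parity k),
      ← TwoSidedIdeal.mem_asIdeal]
    exact Submodule.smul_of_tower_mem _ _ (gen_mem_augIdeal k)
  have hf' := h (TwoSidedIdeal.mem_asIdeal.1 hf)
  rw [TwoSidedIdeal.mem_comap] at hf'
  exact TwoSidedIdeal.mem_asIdeal.2 hf'

theorem continuous_of_leibniz {p : ZMod 2} {D : Module.End ℂ (Lam m n)}
    (h : ∀ i : ZMod 2, ∀ f ∈ parity (m := m) (n := n) i, ∀ g,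
      D (f * g) = D f * g + sgn p i • (f * D g)) : Continuous D := by
  have key : ∀ f ∈ augIdeal m n, ∃ f' ∈ augIdeal m n, ∀ g,
      D (f * g) = D f * g + f' * D g := by
    intro f hf
    have hp := parityAut_mem_augIdeal hf
    obtain ⟨f₀, h₀, f₁, h₁, rfl⟩ := exists_even_add_odd f
    rw [map_add, parityAut_of_mem h₀, parityAut_of_mem h₁] at hp
    rcases zmod_two_cases p with rfl | rfl
    · refine ⟨_, hf, fun g => ?_⟩
      rw [add_mul, map_add, h 0 f₀ h₀ g, h 1 f₁ h₁ g, map_add]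
      simp only [sgn_zero_left, one_smul, add_mul]
      abel
    · refine ⟨_, hp, fun g => ?_⟩
      rw [add_mul, map_add, h 0 f₀ h₀ g, h 1 f₁ h₁ g, map_add]
      simp only [sgn_one_one, sgn_zero_right, one_smul, neg_one_smul, add_mul, neg_mul]
      abel
  have hD : ∀ k : ℕ, ∀ f ∈ augIdeal m n ^ (k + 1), D f ∈ augIdeal m n ^ k := by
    intro k
    induction k with
    | zero => intro f _; rw [Submodule.pow_zero, Ideal.one_eq_top]; trivial
    | succ k ih =>
      intro f hf
      rw [Ideal.IsTwoSided.pow_succ] at hf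
      refine Submodule.mul_induction_on hf ?_ ?_
      · intro a ha b hb
        obtain ⟨a', ha', e⟩ := key a ha
        rw [e]
        refine add_mem (Ideal.mul_mem_left _ _ hb) ?_
        rw [Ideal.IsTwoSided.pow_succ]
        exact Ideal.mul_mem_mul ha' (ih b hb)
      · intro a b ha hb
        rw [map_add]
        exact add_mem ha hb
  rw [continuous_def]
  intro U hU f hf
  obtain ⟨k, hk⟩ := hU (D f) hf
  refine ⟨k + 1, fun g hg => hk _ ?_⟩
  rw [← map_sub]
  exact hD k _ hg

/-- The space `W(m,n)_p` of continuous derivations of parity `p` of `Λ(m,n)`. -/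
def superDer (m n : ℕ) (p : ZMod 2) : Submodule ℂ (Module.End ℂ (Lam m n)) where
  carrier := {D | IsSuperDer p D}
  add_mem' := fun {D E} hD hE => by
    have hl : ∀ i : ZMod 2, ∀ f ∈ parity (m := m) (n := n) i, ∀ g,
        (D + E) (f * g) = (D + E) f * g + sgn p i • (f * (D + E) g) := fun i f hf g => by
      simp only [LinearMap.add_apply, hD.leibniz i f hf, hE.leibniz i f hf, mul_add, add_mul,
        smul_add]
      abel
    exact ⟨fun i f hf => Submodule.add_mem _ (hD.map_parity i f hf) (hE.map_parity i f hf), hl,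
      continuous_of_leibniz hl⟩
  zero_mem' := by
    have hl : ∀ i : ZMod 2, ∀ f ∈ parity (m := m) (n := n) i, ∀ g,
        (0 : Module.End ℂ (Lam m n)) (f * g) = (0 : Module.End ℂ (Lam m n)) f * g +
          sgn p i • (f * (0 : Module.End ℂ (Lam m n)) g) := fun i f hf g => by simp
    exact ⟨fun i f _ => Submodule.zero_mem _, hl, continuous_of_leibniz hl⟩
  smul_mem' := fun c D hD => by
    have hl : ∀ i : ZMod 2, ∀ f ∈ parity (m := m) (n := n) i, ∀ g,
        (c • D) (f * g) = (c • D) f * g + sgn p i • (f * (c • D) g) := fun i f hf g => by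
      simp only [LinearMap.smul_apply, hD.leibniz i f hf, smul_add, smul_mul_assoc,
        mul_smul_comm]
      rw [smul_comm c]
    exact ⟨fun i f hf => Submodule.smul_mem _ c (hD.map_parity i f hf), hl,
      continuous_of_leibniz hl⟩

/-- `W(m,n) = Der Λ(m,n)`, the space of all continuous derivations of `Λ(m,n)`, that is, of sums
of an even and an odd one. -/
abbrev W (m n : ℕ) : Type :=
  ↥(superDer m n 0 ⊔ superDer m n 1 : Submodule ℂ (Module.End ℂ (Lam m n)))

theorem superDer_le (p : ZMod 2) : superDer m n p ≤ superDer m n 0 ⊔ superDer m n 1 := by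
  rcases zmod_two_cases p with rfl | rfl
  · exact le_sup_left
  · exact le_sup_right

/-- The formal topology of `W(m,n)`: identifying `∑ P_i ∂/∂x_i + ∑ Q_j ∂/∂ξ_j` with the family
of its coefficients (its values on the indeterminates), it is the product topology of
`Λ(m,n)^{m+n}`. -/
instance : TopologicalSpace (W m n) :=
  TopologicalSpace.induced (fun X (k : Fin m ⊕ Fin n) => X.1 (gen k)) inferInstance

/-- The superbracket `X Y - (-1)^{p q} Y X` of operators of parities `p` and `q`. -/
def superBracket (p q : ZMod 2) (X Y : Module.End ℂ (Lam m n)) : Module.End ℂ (Lam m n) :=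
  X * Y - sgn p q • (Y * X)

theorem superBracket_mem {p q : ZMod 2} {X Y : Module.End ℂ (Lam m n)}
    (hX : X ∈ superDer m n p) (hY : Y ∈ superDer m n q) :
    superBracket p q X Y ∈ superDer m n (p + q) := by
  have hl : ∀ i : ZMod 2, ∀ f ∈ parity (m := m) (n := n) i, ∀ g,
      superBracket p q X Y (f * g) = superBracket p q X Y f * g +
        sgn (p + q) i • (f * superBracket p q X Y g) := by
    intro i f hf g
    have e₁ := hX.leibniz i f hf
    have e₂ := hY.leibniz i f hf
    have e₃ := hX.leibniz _ _ (hY.map_parity i f hf)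
    have e₄ := hY.leibniz _ _ (hX.map_parity i f hf)
    simp only [superBracket, LinearMap.sub_apply, LinearMap.smul_apply, Module.End.mul_apply,
      e₁, e₂, e₃, e₄, map_add, map_smul]
    have h11 : (1 : ZMod 2) + 1 = 0 := by decide
    rcases zmod_two_cases p with rfl | rfl <;> rcases zmod_two_cases q with rfl | rfl <;>
      rcases zmod_two_cases i with rfl | rfl <;>
      (simp only [sgn_zero_left, sgn_zero_right, sgn_one_one, h11, zero_add, add_zero, one_smul,
        neg_one_smul, mul_sub, sub_mul, mul_neg, neg_mul]
       abel)
  refine ⟨fun i f hf => ?_, hl, continuous_of_leibniz hl⟩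
  refine Submodule.sub_mem _ ?_ (Submodule.smul_mem _ _ ?_)
  · have := hX.map_parity _ _ (hY.map_parity i f hf)
    rwa [add_assoc, add_comm q p] at this
  · have := hY.map_parity _ _ (hX.map_parity i f hf)
    rwa [add_assoc] at this

/-- `L` is a (graded) subalgebra of the Lie superalgebra `W(m,n)`: it contains the even and odd
parts of its elements and is closed under the superbracket. -/
structure IsSubalgebra (L : Submodule ℂ (W m n)) : Prop where
  graded : ∀ X ∈ L, ∃ X₀ ∈ L, ∃ X₁ ∈ L,
    X₀.1 ∈ superDer m n 0 ∧ X₁.1 ∈ superDer m n 1 ∧ X = X₀ + X₁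
  bracket_mem : ∀ p q : ZMod 2, ∀ X ∈ L, ∀ Y ∈ L,
    ∀ (hX : X.1 ∈ superDer m n p) (hY : Y.1 ∈ superDer m n q),
      (⟨superBracket p q X.1 Y.1, superDer_le _ (superBracket_mem hX hY)⟩ : W m n) ∈ L

/-- `∂/∂x_i` as an operator on `Λ(m,n)`. -/
def partialEven (i : Fin m) : Module.End ℂ (Lam m n) where
  toFun := MvPowerSeries.pderivFun i
  map_add' := MvPowerSeries.pderivFun_add
  map_smul' := fun c f => by
    ext d
    change (c • MvPowerSeries.coeff (d + Finsupp.single i 1) f) * _ = c • (_ * _)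
    rw [smul_mul_assoc]

/-- `∂/∂ξ_j` as an operator on `Λ(m,n)`: on each coefficient it is the (left) contraction with
the `j`-th coordinate function, the odd derivation of `Λ(n)` with `ξ_k ↦ δ_{jk}`. -/
def partialOdd (j : Fin n) : Module.End ℂ (Lam m n) where
  toFun f := fun d => CliffordAlgebra.contractLeft (Q := (0 : QuadraticForm ℂ (Fin n → ℂ)))
    (LinearMap.proj j) (MvPowerSeries.coeff d f)
  map_add' := fun f g => by
    funext d
    exact LinearMap.map_add _ _ _
  map_smul' := fun c f => by
    funext d
    exact LinearMap.map_smul _ _ _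

theorem contractLeft_mul (φ : Module.Dual ℂ (Fin n → ℂ)) (a b : Grassmann n) :
    CliffordAlgebra.contractLeft (Q := (0 : QuadraticForm ℂ (Fin n → ℂ))) φ (a * b) =
      CliffordAlgebra.contractLeft φ a * b +
        CliffordAlgebra.involute a * CliffordAlgebra.contractLeft φ b := by
  induction a using CliffordAlgebra.left_induction with
  | algebraMap r => simp [CliffordAlgebra.contractLeft_algebraMap_mul]
  | add x y hx hy => simp only [add_mul, map_add, hx, hy]; abel
  | ι_mul x v hx =>
    rw [mul_assoc, CliffordAlgebra.contractLeft_ι_mul, hx, CliffordAlgebra.contractLeft_ι_mul,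
      map_mul, CliffordAlgebra.involute_ι, sub_mul, smul_mul_assoc, mul_add]
    noncomm_ring

theorem sum_antidiagonal_fst (i : Fin m) (d : Fin m →₀ ℕ)
    (F : (Fin m →₀ ℕ) → (Fin m →₀ ℕ) → Grassmann n) :
    ∑ p ∈ Finset.HasAntidiagonal.antidiagonal (d + Finsupp.single i 1),
        ((p.1 : Fin m →₀ ℕ) i) • F p.1 p.2 =
      ∑ p ∈ Finset.HasAntidiagonal.antidiagonal d, (p.1 i + 1) • F (p.1 + Finsupp.single i 1) p.2 := by
  classical
  symm
  refine Finset.sum_of_injOn (fun p => (p.1 + Finsupp.single i 1, p.2)) ?_ ?_ ?_ ?_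
  · rintro ⟨a, b⟩ - ⟨a', b'⟩ - h
    simpa using h
  · rintro ⟨a, b⟩ h
    rw [Finset.mem_coe, Finset.HasAntidiagonal.mem_antidiagonal] at h ⊢
    rw [← h, add_right_comm]
  · rintro ⟨a, b⟩ h h'
    by_cases ha : a i = 0
    · simp [ha]
    · exfalso
      have hle : Finsupp.single i 1 ≤ a := by
        rw [Finsupp.single_le_iff]; omega
      refine h' ⟨(a - Finsupp.single i 1, b), ?_, ?_⟩
      · rw [Finset.HasAntidiagonal.mem_antidiagonal] at h
        rw [Finset.mem_coe, Finset.HasAntidiagonal.mem_antidiagonal]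
        have h2 : a - Finsupp.single i 1 + b + Finsupp.single i 1 = d + Finsupp.single i 1 := by
          rw [add_right_comm, tsub_add_cancel_of_le hle]; exact h
        exact add_right_cancel h2
      · simp [tsub_add_cancel_of_le hle]
  · rintro ⟨a, b⟩ _
    simp

theorem sum_antidiagonal_snd (i : Fin m) (d : Fin m →₀ ℕ)
    (F : (Fin m →₀ ℕ) → (Fin m →₀ ℕ) → Grassmann n) :
    ∑ p ∈ Finset.HasAntidiagonal.antidiagonal (d + Finsupp.single i 1),
        ((p.2 : Fin m →₀ ℕ) i) • F p.1 p.2 =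
      ∑ p ∈ Finset.HasAntidiagonal.antidiagonal d, (p.2 i + 1) • F p.1 (p.2 + Finsupp.single i 1) := by
  have h := sum_antidiagonal_fst i d (fun a b => F b a)
  have e₁ := Finsupp.sum_antidiagonal_swap (d + Finsupp.single i 1)
    (fun a b => (a i) • F b a)
  have e₂ := Finsupp.sum_antidiagonal_swap d
    (fun a b => (a i + 1) • F b (a + Finsupp.single i 1))
  exact e₁.symm.trans (h.trans e₂)

theorem coeff_partialEven (i : Fin m) (f : Lam m n) (d : Fin m →₀ ℕ) :
    MvPowerSeries.coeff d (partialEven i f) =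
      (d i + 1) • MvPowerSeries.coeff (d + Finsupp.single i 1) f := by
  rw [nsmul_eq_mul, Nat.cast_comm, Nat.cast_add, Nat.cast_one]
  rfl

theorem partialEven_mem (i : Fin m) :
    (partialEven i : Module.End ℂ (Lam m n)) ∈ superDer m n 0 := by
  have hl : ∀ k : ZMod 2, ∀ f ∈ parity (m := m) (n := n) k, ∀ g,
      (partialEven i : Module.End ℂ (Lam m n)) (f * g) =
        partialEven i f * g + sgn 0 k • (f * partialEven i g) := by
    intro k f _ g
    classical
    rw [sgn_zero_left, one_smul]
    ext d
    rw [coeff_partialEven, map_add, MvPowerSeries.coeff_mul, MvPowerSeries.coeff_mul,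
      MvPowerSeries.coeff_mul]
    simp only [coeff_partialEven, smul_mul_assoc, mul_smul_comm]
    rw [← sum_antidiagonal_fst i d
        (fun a b => MvPowerSeries.coeff a f * MvPowerSeries.coeff b g),
      ← sum_antidiagonal_snd i d
        (fun a b => MvPowerSeries.coeff a f * MvPowerSeries.coeff b g),
      ← Finset.sum_add_distrib, Finset.smul_sum]
    refine Finset.sum_congr rfl fun p hp => ?_
    rw [← add_smul]
    congr 1
    have := DFunLike.congr_fun (Finset.HasAntidiagonal.mem_antidiagonal.1 hp) i
    simpa using this.symm
  refine ⟨fun k f hf d => ?_, hl, continuous_of_leibniz hl⟩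
  rw [coeff_partialEven, add_zero]
  exact nsmul_mem (hf _) _

theorem contractLeft_mem (φ : Module.Dual ℂ (Fin n → ℂ)) {i : ZMod 2} {a : Grassmann n}
    (ha : a ∈ CliffordAlgebra.evenOdd (0 : QuadraticForm ℂ (Fin n → ℂ)) i) :
    CliffordAlgebra.contractLeft φ a ∈
      CliffordAlgebra.evenOdd (0 : QuadraticForm ℂ (Fin n → ℂ)) (i + 1) := by
  have step : ∀ (j : ZMod 2) (v w : Fin n → ℂ) (x : Grassmann n),
      x ∈ CliffordAlgebra.evenOdd (0 : QuadraticForm ℂ (Fin n → ℂ)) j →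
      CliffordAlgebra.contractLeft φ x ∈
        CliffordAlgebra.evenOdd (0 : QuadraticForm ℂ (Fin n → ℂ)) (j + 1) →
      CliffordAlgebra.contractLeft φ (CliffordAlgebra.ι 0 v * CliffordAlgebra.ι 0 w * x) ∈
        CliffordAlgebra.evenOdd (0 : QuadraticForm ℂ (Fin n → ℂ)) (j + 1) := by
    intro j v w x hx hdx
    have hv := CliffordAlgebra.ι_mem_evenOdd_one (0 : QuadraticForm ℂ (Fin n → ℂ)) v
    have hw := CliffordAlgebra.ι_mem_evenOdd_one (0 : QuadraticForm ℂ (Fin n → ℂ)) w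
    have h1 := SetLike.mul_mem_graded hw hx
    have h2 := SetLike.mul_mem_graded hv hx
    have h3 := SetLike.mul_mem_graded hv (SetLike.mul_mem_graded hw hdx)
    rw [mul_assoc, CliffordAlgebra.contractLeft_ι_mul, CliffordAlgebra.contractLeft_ι_mul,
      mul_sub, mul_smul_comm]
    have e3 : (1 : ZMod 2) + (1 + (j + 1)) = j + 1 := by
      rw [← add_assoc, show (1 : ZMod 2) + 1 = 0 by decide, zero_add]
    rw [e3] at h3
    rw [add_comm 1 j] at h1 h2
    exact sub_mem (Submodule.smul_mem _ _ h1) (sub_mem (Submodule.smul_mem _ _ h2) h3)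
  rcases zmod_two_cases i with rfl | rfl
  · induction a, ha using CliffordAlgebra.even_induction with
    | algebraMap r => rw [CliffordAlgebra.contractLeft_algebraMap]; exact Submodule.zero_mem _
    | add x y hx hy ihx ihy => rw [map_add]; exact add_mem ihx ihy
    | ι_mul_ι_mul v w x hx ih => exact step 0 v w x hx ih
  · induction a, ha using CliffordAlgebra.odd_induction with
    | ι v =>
      rw [CliffordAlgebra.contractLeft_ι]
      exact CliffordAlgebra.one_le_evenOdd_zero _ (Submodule.mem_one.2 ⟨_, rfl⟩)
    | add x y hx hy ihx ihy => rw [map_add]; exact add_mem ihx ihy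
    | ι_mul_ι_mul v w x hx ih => exact step 1 v w x hx ih

theorem partialOdd_mem (j : Fin n) :
    (partialOdd j : Module.End ℂ (Lam m n)) ∈ superDer m n 1 := by
  have hl : ∀ i : ZMod 2, ∀ f ∈ parity (m := m) (n := n) i, ∀ g,
      (partialOdd j : Module.End ℂ (Lam m n)) (f * g) =
        partialOdd j f * g + sgn 1 i • (f * partialOdd j g) := by
    intro i f hf g
    classical
    have hc : ∀ (h : Lam m n) d, MvPowerSeries.coeff d (partialOdd j h) =
      CliffordAlgebra.contractLeft (Q := (0 : QuadraticForm ℂ (Fin n → ℂ)))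
        (LinearMap.proj j) (MvPowerSeries.coeff d h) := fun _ _ => rfl
    rw [← smul_mul_assoc, ← parityAut_of_mem hf]
    ext d
    rw [hc, map_add, MvPowerSeries.coeff_mul, MvPowerSeries.coeff_mul, MvPowerSeries.coeff_mul,
      map_sum, ← Finset.sum_add_distrib]
    refine Finset.sum_congr rfl fun x _ => ?_
    rw [contractLeft_mul, hc, hc, coeff_parityAut]
  exact ⟨fun i f hf d => contractLeft_mem _ (hf d), hl, continuous_of_leibniz hl⟩

/-- The basis `∂/∂x_1, …, ∂/∂x_m, ∂/∂ξ_1, …, ∂/∂ξ_n` of `W(m,n)_{-1}`. -/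
def partialGen : Fin m ⊕ Fin n → W m n :=
  Sum.elim (fun i => ⟨partialEven i, superDer_le 0 (partialEven_mem i)⟩)
    (fun j => ⟨partialOdd j, superDer_le 1 (partialOdd_mem j)⟩)

/-- The component `W(m,n)_{-1}` of the principal grading. -/
def degNegOne (m n : ℕ) : Submodule ℂ (W m n) := Submodule.span ℂ (Set.range partialGen)

/-- The constant term `f(0)` of `f ∈ Λ(m,n)`. -/
def constTerm : Lam m n →ₗ[ℂ] ℂ :=
  ExteriorAlgebra.algebraMapInv.toLinearMap ∘ₗ
    ((MvPowerSeries.coeff (0 : Fin m →₀ ℕ) : Lam m n →ₗ[Grassmann n] Grassmann n).restrictScalars ℂ)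

/-- The projection of `W(m,n)` onto `W(m,n)_{-1}`:
`∑ P_i ∂/∂x_i + ∑ Q_j ∂/∂ξ_j ↦ ∑ P_i(0) ∂/∂x_i + ∑ Q_j(0) ∂/∂ξ_j`. -/
def projNegOne : W m n →ₗ[ℂ] W m n where
  toFun X := ∑ k, constTerm (X.1 (gen k)) • partialGen k
  map_add' X Y := by
    simp only [← Finset.sum_add_distrib, ← add_smul, ← map_add]
    rfl
  map_smul' c X := by
    rw [RingHom.id_apply, Finset.smul_sum]
    refine Finset.sum_congr rfl fun k _ => ?_
    rw [smul_smul, ← smul_eq_mul, ← map_smul constTerm]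
    rfl

/-- `L` is transitive: its projection on `W(m,n)_{-1}` is onto. -/
def IsTransitive (L : Submodule ℂ (W m n)) : Prop := L.map projNegOne = degNegOne m n

/-- For `V ⊆ W(m,n)_{-1}`, the subspace `V*` of `∑ ℂ x_i + ∑ ℂ ξ_j` of the linear forms which
vanish on `V` under the duality `⟨∂, u⟩ = ∂(u)`. -/
def dualSubspace (V : Submodule ℂ (W m n)) : Submodule ℂ (Lam m n) where
  carrier := {u | u ∈ Submodule.span ℂ (Set.range (gen : Fin m ⊕ Fin n → Lam m n)) ∧
    ∀ X ∈ V, X.1 u = 0}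
  add_mem' := fun hu hv => ⟨Submodule.add_mem _ hu.1 hv.1, fun X hX => by
    rw [map_add, hu.2 X hX, hv.2 X hX, add_zero]⟩
  zero_mem' := ⟨Submodule.zero_mem _, fun X _ => map_zero _⟩
  smul_mem' := fun c _ hu => ⟨Submodule.smul_mem _ c hu.1, fun X hX => by
    rw [map_smul, hu.2 X hX, smul_zero]⟩

/-- The ideal `I_U` of `Λ(m,n)` generated by `U`. -/
def stdIdeal (U : Submodule ℂ (Lam m n)) : TwoSidedIdeal (Lam m n) :=
  TwoSidedIdeal.span (U : Set (Lam m n))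

/-- `W_U = {X ∈ W(m,n) | X I_U ⊆ I_U}`. -/
def stdSubalgebra (U : Submodule ℂ (Lam m n)) : Submodule ℂ (W m n) where
  carrier := {X | ∀ f ∈ stdIdeal U, X.1 f ∈ stdIdeal U}
  add_mem' := fun hX hY f hf => TwoSidedIdeal.add_mem _ (hX f hf) (hY f hf)
  zero_mem' := fun _ _ => TwoSidedIdeal.zero_mem _
  smul_mem' := fun c X hX f hf => by
    have : (c • X).1 f = (algebraMap ℂ (Lam m n) c) * X.1 f := Algebra.smul_def c (X.1 f)
    rw [this]
    exact TwoSidedIdeal.mul_mem_left _ _ _ (hX f hf)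

/-- A continuous automorphism of the topological superalgebra `Λ(m,n)`: a bicontinuous,
parity-preserving automorphism of the algebra. -/
structure ContAut (m n : ℕ) where
  toAlgEquiv : Lam m n ≃ₐ[ℂ] Lam m n
  mem_parity_iff : ∀ (i : ZMod 2) (f : Lam m n), toAlgEquiv f ∈ parity i ↔ f ∈ parity i
  continuous_toFun : Continuous toAlgEquiv
  continuous_invFun : Continuous toAlgEquiv.symm

theorem conj_mem (φ : ContAut m n) {p : ZMod 2} {X : Module.End ℂ (Lam m n)}
    (hX : X ∈ superDer m n p) : φ.toAlgEquiv.toLinearEquiv.conj X ∈ superDer m n p := by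
  have hs : ∀ (i : ZMod 2) (f : Lam m n), f ∈ parity i → φ.toAlgEquiv.symm f ∈ parity i :=
    fun i f hf => by
      rw [← φ.mem_parity_iff, AlgEquiv.apply_symm_apply]; exact hf
  have hc : ∀ f, φ.toAlgEquiv.toLinearEquiv.conj X f =
    φ.toAlgEquiv (X (φ.toAlgEquiv.symm f)) := fun _ => rfl
  have hl : ∀ i : ZMod 2, ∀ f ∈ parity (m := m) (n := n) i, ∀ g,
      φ.toAlgEquiv.toLinearEquiv.conj X (f * g) = φ.toAlgEquiv.toLinearEquiv.conj X f * g +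
        sgn p i • (f * φ.toAlgEquiv.toLinearEquiv.conj X g) := fun i f hf g => by
    rw [hc, hc, hc, map_mul, hX.leibniz i _ (hs i f hf), map_add, map_smul, map_mul, map_mul,
      AlgEquiv.apply_symm_apply, AlgEquiv.apply_symm_apply]
  exact ⟨fun i f hf => (φ.mem_parity_iff _ _).2 (hX.map_parity i _ (hs i f hf)), hl,
    continuous_of_leibniz hl⟩

/-- The automorphism `X ↦ φ X φ⁻¹` of `W(m,n)` induced by an automorphism `φ` of `Λ(m,n)`. -/
def ContAut.induced (φ : ContAut m n) : W m n →ₗ[ℂ] W m n :=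
  φ.toAlgEquiv.toLinearEquiv.conj.toLinearMap.restrict (fun X hX => by
    obtain ⟨X₀, h₀, X₁, h₁, rfl⟩ := Submodule.mem_sup.1 hX
    rw [map_add]
    exact Submodule.add_mem_sup (conj_mem φ h₀) (conj_mem φ h₁))

/-- The ideal `I` of `Λ(m,n)` is `L`-invariant. -/
def IsInvariant (L : Submodule ℂ (W m n)) (I : TwoSidedIdeal (Lam m n)) : Prop :=
  ∀ X ∈ L, ∀ f ∈ I, X.1 f ∈ I

/-- The ideal `I` of `Λ(m,n)` is graded: it contains the even and odd parts of its elements. -/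
def IsGradedIdeal (I : TwoSidedIdeal (Lam m n)) : Prop :=
  ∀ f ∈ I, ∃ f₀ ∈ I, ∃ f₁ ∈ I, f₀ ∈ parity (m := m) (n := n) 0 ∧
    f₁ ∈ parity (m := m) (n := n) 1 ∧ f = f₀ + f₁

end FormalSuper

end

/-! Write `V` for the projection of `L` on the constant derivations and `I` for the ideal generated
by `V*`. Choose homogeneous `X_i` in `L` whose projections `v_i` form a basis of `V`, and linear
forms `t_i` of the same parities with `v_i(t_j) = δ_ij`. Let `E` be the algebra endomorphism that
substitutes `0` for every `t_i`; its values on the indeterminates span `V*`. The straightening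
automorphism is the Taylor expansion along the flows of the `X_i`: `Φ(f) = ∑ t^a / a! · E(X^a f)`,
summed over ordered monomials `X^a`, with exponents at most one at odd indices. It is built as `E`
followed by successive composition with `exp(t_i X_i)`, where `t_i` is treated as a constant
(`Frame.exists_flow`). Modulo the square of the maximal ideal it fixes the indeterminates, so it is
a continuous automorphism (`exists_contAut`).

The point is that `Φ⁻¹(I)` is the set of all `f` for which every word in `L` applied to `f` vanishes
at the origin (`wordKernel`, `exists_straightening`). If `Φ(f)` lies in `I`, then, because the `v_i`
preserve `I`, all the Taylor coefficients `E(X^a f)` lie in `I` (`IsExp.apply_mem_of_mem`), so each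
`X^a f` vanishes at the origin. A Poincaré–Birkhoff–Witt argument extends this from ordered
monomials to all words (`OrdVanish.all_words`): letters may be permuted up to sign and shorter
words, and a letter with zero projection may be moved to the far left, where it maps everything into
the maximal ideal. Conversely, `Φ` maps every `L`-invariant subset of the maximal ideal into `I`,
since `E` maps the maximal ideal into `I` and `I` is closed.

Thus `Φ⁻¹(I)` is `L`-invariant, which is (a). For (b), a proper invariant ideal lies in the maximal
ideal, so `Φ` maps it into `I`, which is zero when `L` is transitive. If `L` is not transitive, then
`V*` is nonzero and `Φ⁻¹(I)` is itself a closed graded invariant ideal different from `0` and the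
whole algebra. -/

noncomputable section

/-! ### Convergent series and exponentials of derivations in a complete filtered superalgebra. -/

namespace FilteredSuper

open Finset

/-- The automorphism `σ ^ p`. -/
def twist {R : Type*} [Ring R] (σ : R →+* R) (p : ZMod 2) : R →+* R :=
  if p = 0 then RingHom.id R else σ

@[simp] theorem twist_zero {R : Type*} [Ring R] (σ : R →+* R) : twist σ 0 = RingHom.id R := if_pos rfl

@[simp] theorem twist_one {R : Type*} [Ring R] (σ : R →+* R) : twist σ 1 = σ := if_neg (by decide)

variable {A : Type*} [Ring A] [Algebra ℂ A]

/-- A decreasing multiplicative filtration for which the algebra is Hausdorff and complete. -/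
structure IsCompleteFiltration (F : ℕ → Submodule ℂ A) : Prop where
  zero_eq_top : F 0 = ⊤
  anti : Antitone F
  mul_mem : ∀ {i j : ℕ} {a b : A}, a ∈ F i → b ∈ F j → a * b ∈ F (i + j)
  eq_zero : ∀ {a : A}, (∀ k, a ∈ F k) → a = 0
  exists_sum : ∀ s : ℕ → A, (∀ k, s k ∈ F k) →
    ∃ S, ∀ K, S - ∑ k ∈ range K, s k ∈ F K

/-- The series `∑ s k` converges to `S`, its `K`-th remainder lying in `F K`. -/
def IsSum (F : ℕ → Submodule ℂ A) (s : ℕ → A) (S : A) : Prop :=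
  ∀ K, S - ∑ k ∈ range K, s k ∈ F K

variable {F : ℕ → Submodule ℂ A}

namespace IsCompleteFiltration

theorem mul_mem_left (hF : IsCompleteFiltration F) {i : ℕ} (a : A) {b : A} (hb : b ∈ F i) :
    a * b ∈ F i := by
  have : a ∈ F 0 := hF.zero_eq_top ▸ Submodule.mem_top
  simpa using hF.mul_mem this hb

theorem mul_mem_right (hF : IsCompleteFiltration F) {i : ℕ} {a : A} (b : A) (ha : a ∈ F i) :
    a * b ∈ F i := by
  have : b ∈ F 0 := hF.zero_eq_top ▸ Submodule.mem_top
  simpa using hF.mul_mem ha this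

theorem pow_mem (hF : IsCompleteFiltration F) {t : A} (ht : t ∈ F 1) (k : ℕ) : t ^ k ∈ F k := by
  induction k with
  | zero => rw [hF.zero_eq_top]; trivial
  | succ k ih => rw [pow_succ]; exact hF.mul_mem ih ht

theorem eq_of_sub_mem (hF : IsCompleteFiltration F) {a b : A} (h : ∀ k, a - b ∈ F k) : a = b :=
  sub_eq_zero.1 (hF.eq_zero h)

end IsCompleteFiltration

theorem IsSum.mem (hF : IsCompleteFiltration F) {s : ℕ → A} {S : A} (h : IsSum F s S) (k : ℕ) :
    s k ∈ F k := by
  have := Submodule.sub_mem _ (h k) (hF.anti (Nat.le_succ k) (h (k + 1)))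
  rwa [sum_range_succ, sub_sub_sub_cancel_left, add_sub_cancel_left] at this

theorem IsSum.unique (hF : IsCompleteFiltration F) {s : ℕ → A} {S T : A} (h : IsSum F s S)
    (h' : IsSum F s T) : S = T :=
  hF.eq_of_sub_mem fun k => by
    have := Submodule.sub_mem _ (h k) (h' k)
    rwa [sub_sub_sub_cancel_right] at this

theorem IsSum.add {s u : ℕ → A} {S U : A} (h : IsSum F s S) (h' : IsSum F u U) :
    IsSum F (fun k => s k + u k) (S + U) := fun K => by
  have := Submodule.add_mem _ (h K) (h' K)
  rwa [sum_add_distrib, add_sub_add_comm]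

theorem IsSum.smul {s : ℕ → A} {S : A} (c : ℂ) (h : IsSum F s S) :
    IsSum F (fun k => c • s k) (c • S) := fun K => by
  have := Submodule.smul_mem _ c (h K)
  rwa [← smul_sum, ← smul_sub]

theorem IsSum.finset_sum {ι : Type*} (T : Finset ι) {s : ι → ℕ → A} {S : ι → A}
    (h : ∀ i ∈ T, IsSum F (s i) (S i)) :
    IsSum F (fun k => ∑ i ∈ T, s i k) (∑ i ∈ T, S i) := fun K => by
  rw [sum_comm, ← sum_sub_distrib]
  exact Submodule.sum_mem _ fun i hi => h i hi K

theorem IsSum.mul_left (hF : IsCompleteFiltration F) {s : ℕ → A} {S : A} (a : A)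
    (h : IsSum F s S) : IsSum F (fun k => a * s k) (a * S) := fun K => by
  rw [← mul_sum, ← mul_sub]
  exact hF.mul_mem_left a (h K)

theorem IsSum.map {s : ℕ → A} {S : A} (f : A →+ A) (hf : ∀ k, ∀ a ∈ F k, f a ∈ F k)
    (h : IsSum F s S) : IsSum F (fun k => f (s k)) (f S) := fun K => by
  rw [← map_sum, ← map_sub]
  exact hf K _ (h K)

theorem isSum_of_eq_zero {s : ℕ → A} (N : ℕ) (hs : ∀ k, N ≤ k → s k = 0)
    (hm : ∀ k, s k ∈ F k) (hF : IsCompleteFiltration F) :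
    IsSum F s (∑ k ∈ range N, s k) := fun K => by
  rcases le_total N K with h | h
  · have : ∑ k ∈ range K, s k = ∑ k ∈ range N, s k := by
      refine (sum_subset (range_subset_range.2 h) fun k _ hk => hs k ?_).symm
      simpa using hk
    rw [this, sub_self]
    exact Submodule.zero_mem _
  · rw [← sum_range_add_sum_Ico _ h, add_sub_cancel_left]
    exact Submodule.sum_mem _ fun k hk => hF.anti (mem_Ico.1 hk).1 (hm k)

/-- Grouping the Cauchy product by the first index pairs `s i` with a partial sum of length `K - i`,
which is what the remainder estimate for products needs. -/
theorem sum_range_antidiagonal {R : Type*} [NonUnitalNonAssocRing R] (s u : ℕ → R) (K : ℕ) :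
    ∑ k ∈ range K, ∑ p ∈ antidiagonal k, s p.1 * u p.2 =
      ∑ i ∈ range K, s i * ∑ j ∈ range (K - i), u j := by
  induction K with
  | zero => simp
  | succ K ih =>
    rw [sum_range_succ, ih, Finset.Nat.sum_antidiagonal_eq_sum_range_succ (fun i j => s i * u j),
      sum_range_succ, sum_range_succ (fun i => s i * ∑ j ∈ range (K + 1 - i), u j), ← add_assoc,
      ← sum_add_distrib]
    congr 1
    · refine sum_congr rfl fun i hi => ?_
      rw [Nat.succ_sub (mem_range.1 hi).le, sum_range_succ, mul_add]
    · simp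

theorem IsSum.mul (hF : IsCompleteFiltration F) {s u : ℕ → A} {S U : A} (h : IsSum F s S)
    (h' : IsSum F u U) :
    IsSum F (fun k => ∑ p ∈ antidiagonal k, s p.1 * u p.2) (S * U) := fun K => by
  rw [sum_range_antidiagonal]
  -- In the last sum `s i` lies in step `i` and the remainder of `U` in step `K - i`, so each
  -- product lies in step `K`.
  have e : S * U - ∑ i ∈ range K, s i * ∑ j ∈ range (K - i), u j =
      (S - ∑ i ∈ range K, s i) * U +
        ∑ i ∈ range K, s i * (U - ∑ j ∈ range (K - i), u j) := by
    simp only [mul_sub, sum_sub_distrib, sub_mul, sum_mul]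
    abel
  rw [e]
  refine Submodule.add_mem _ (hF.mul_mem_right _ (h K)) (Submodule.sum_mem _ fun i hi => ?_)
  have := hF.mul_mem (h.mem hF i) (h' (K - i))
  rwa [Nat.add_sub_cancel' (mem_range.1 hi).le] at this

/-- `D` is a derivation of parity `p` of the superalgebra with parity automorphism `σ`. -/
structure IsDer (F : ℕ → Submodule ℂ A) (σ : A →+* A) (p : ZMod 2) (D : Module.End ℂ A) : Prop where
  leibniz : ∀ a b, D (a * b) = D a * b + twist σ p a * D b
  parity_apply : ∀ a, σ (D a) = FormalSuper.sgn 1 p • D (σ a)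
  lowers : ∀ k, ∀ a ∈ F (k + 1), D a ∈ F k

theorem IsDer.map_one {σ : A →+* A} {p : ZMod 2} {D : Module.End ℂ A} (h : IsDer F σ p D) :
    D 1 = 0 := by
  have := h.leibniz 1 1
  simpa using this

theorem IsDer.map_algebraMap {σ : A →+* A} {p : ZMod 2} {D : Module.End ℂ A} (h : IsDer F σ p D)
    (c : ℂ) : D (algebraMap ℂ A c) = 0 := by
  rw [Algebra.algebraMap_eq_smul_one, map_smul, h.map_one, smul_zero]

/-- An algebra endomorphism which preserves the filtration and the parity. -/
structure IsGradedLocal (F : ℕ → Submodule ℂ A) (σ : A →+* A) (Ψ : A →ₐ[ℂ] A) : Prop where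
  map_mem : ∀ k, ∀ a ∈ F k, Ψ a ∈ F k
  comm : ∀ a, Ψ (σ a) = σ (Ψ a)

/-- `t` is an element of the augmentation ideal which is homogeneous of parity `p`. -/
structure IsParam (F : ℕ → Submodule ℂ A) (σ : A →+* A) (p : ZMod 2) (t : A) : Prop where
  mem : t ∈ F 1
  parity_apply : σ t = FormalSuper.sgn 1 p • t
  mul_comm : ∀ a, a * t = t * twist σ p a
  sq : p = 1 → t * t = 0

theorem IsParam.neg {σ : A →+* A} {p : ZMod 2} {t : A} (h : IsParam F σ p t) :
    IsParam F σ p (-t) where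
  mem := Submodule.neg_mem _ h.mem
  parity_apply := by rw [map_neg, h.parity_apply, smul_neg]
  mul_comm a := by rw [mul_neg, h.mul_comm, neg_mul]
  sq hp := by rw [neg_mul_neg, h.sq hp]

/-- The `k`-th term of the series `∑ tᵏ / k! Ψ(Xᵏ f)`. -/
def expTerm (t : A) (X : Module.End ℂ A) (Ψ : A →ₐ[ℂ] A) (f : A) (k : ℕ) : A :=
  ((k.factorial : ℂ)⁻¹) • (t ^ k * Ψ ((X ^ k) f))

/-- `Ψ'` is the composite `Ψ ∘ exp(t X)`, where `t` is not acted upon by `X`. -/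
def IsExp (F : ℕ → Submodule ℂ A) (t : A) (X : Module.End ℂ A) (Ψ Ψ' : A →ₐ[ℂ] A) : Prop :=
  ∀ f, IsSum F (expTerm t X Ψ f) (Ψ' f)

theorem expTerm_mem (hF : IsCompleteFiltration F) {t : A} (ht : t ∈ F 1) (X : Module.End ℂ A)
    (Ψ : A →ₐ[ℂ] A) (f : A) (k : ℕ) : expTerm t X Ψ f k ∈ F k :=
  Submodule.smul_mem _ _ (hF.mul_mem_right _ (hF.pow_mem ht k))

@[simp] theorem expTerm_zero (t : A) (X : Module.End ℂ A) (Ψ : A →ₐ[ℂ] A) (f : A) :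
    expTerm t X Ψ f 0 = Ψ f := by simp [expTerm]

@[simp] theorem expTerm_one (t : A) (X : Module.End ℂ A) (Ψ : A →ₐ[ℂ] A) (f : A) :
    expTerm t X Ψ f 1 = t * Ψ (X f) := by simp [expTerm]

theorem expTerm_of_sq {t : A} (ht : t * t = 0) (X : Module.End ℂ A) (Ψ : A →ₐ[ℂ] A) (f : A)
    (k : ℕ) (hk : 2 ≤ k) : expTerm t X Ψ f k = 0 := by
  obtain ⟨l, rfl⟩ := Nat.exists_eq_add_of_le hk
  rw [expTerm, pow_add, pow_two, ht, zero_mul, zero_mul, smul_zero]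

theorem expTerm_of_eq_zero (t : A) (X : Module.End ℂ A) (Ψ : A →ₐ[ℂ] A) {f : A} {N : ℕ}
    (hf : (X ^ N) f = 0) (k : ℕ) (hk : N ≤ k) : expTerm t X Ψ f k = 0 := by
  obtain ⟨l, rfl⟩ := Nat.exists_eq_add_of_le hk
  rw [expTerm, add_comm N l, pow_add X, Module.End.mul_apply, hf, map_zero, map_zero, mul_zero,
    smul_zero]

theorem IsExp.apply_of_eq_zero (hF : IsCompleteFiltration F) {t : A} (ht : t ∈ F 1)
    {X : Module.End ℂ A} {Ψ Ψ' : A →ₐ[ℂ] A} (h : IsExp F t X Ψ Ψ') {f : A} {N : ℕ}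
    (hf : (X ^ N) f = 0) : Ψ' f = ∑ k ∈ range N, expTerm t X Ψ f k :=
  (h f).unique hF
    (isSum_of_eq_zero N (expTerm_of_eq_zero t X Ψ hf) (expTerm_mem hF ht X Ψ f) hF)

theorem pow_apply_mul {σ : A →+* A} {X : Module.End ℂ A} (hX : IsDer F σ 0 X) (f g : A) (k : ℕ) :
    (X ^ k) (f * g) =
      ∑ p ∈ antidiagonal k, k.choose p.1 • ((X ^ p.1) f * (X ^ p.2) g) := by
  induction k with
  | zero => simp
  | succ k ih =>
    rw [sum_antidiagonal_choose_succ_nsmul (fun i j => (X ^ i) f * (X ^ j) g) k, pow_succ',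
      Module.End.mul_apply, ih, map_sum, ← sum_add_distrib]
    refine sum_congr rfl fun p hp => ?_
    have hc : k.choose p.2 = k.choose p.1 := by
      rw [← mem_antidiagonal.1 hp, Nat.choose_symm_add]
    rw [map_nsmul, hX.leibniz, hc, pow_succ', pow_succ', ← nsmul_add]
    simp [add_comm]

/-- An even `t` is central, so the binomial coefficients of the Leibniz rule cancel against the
factorials and leave a Cauchy product. This gives the multiplicativity of `exp(tX)`. -/
theorem expTerm_mul {σ : A →+* A} {t : A} (ht : IsParam F σ 0 t) {X : Module.End ℂ A}
    (hX : IsDer F σ 0 X) (Ψ : A →ₐ[ℂ] A) (f g : A) (k : ℕ) :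
    expTerm t X Ψ (f * g) k =
      ∑ p ∈ antidiagonal k, expTerm t X Ψ f p.1 * expTerm t X Ψ g p.2 := by
  rw [expTerm, pow_apply_mul hX, map_sum, mul_sum, smul_sum]
  refine sum_congr rfl fun p hp => ?_
  have hc : ∀ a, a * t ^ p.2 = t ^ p.2 * a := fun a =>
    (Commute.pow_right (show Commute a t from (ht.mul_comm a).trans (by simp)) p.2).eq
  have hk := mem_antidiagonal.1 hp
  have hch : ((k.factorial : ℂ)⁻¹) * (k.choose p.1 : ℂ) =
      (p.1.factorial : ℂ)⁻¹ * (p.2.factorial : ℂ)⁻¹ := by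
    have h1 : (p.1.factorial : ℂ) ≠ 0 := by exact_mod_cast p.1.factorial_ne_zero
    have h2 : (p.2.factorial : ℂ) ≠ 0 := by exact_mod_cast p.2.factorial_ne_zero
    have h3 : (k.factorial : ℂ) ≠ 0 := by exact_mod_cast k.factorial_ne_zero
    have := Nat.choose_mul_factorial_mul_factorial (hk ▸ Nat.le_add_right p.1 p.2 : p.1 ≤ k)
    rw [show k - p.1 = p.2 by omega] at this
    have : (k.choose p.1 : ℂ) * p.1.factorial * p.2.factorial = k.factorial := by
      exact_mod_cast this
    field_simp
    linear_combination this
  rw [map_nsmul, map_mul, ← Nat.cast_smul_eq_nsmul ℂ, mul_smul_comm, smul_smul, hch, expTerm,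
    expTerm, smul_mul_smul_comm, ← hk, pow_add, mul_assoc (t ^ p.1), mul_assoc (t ^ p.1),
    ← mul_assoc (Ψ _) (t ^ p.2), hc, mul_assoc]

theorem IsExp.apply_of_odd (hF : IsCompleteFiltration F) {σ : A →+* A} {t : A}
    (ht : IsParam F σ 1 t) {X : Module.End ℂ A} {Ψ Ψ' : A →ₐ[ℂ] A} (h : IsExp F t X Ψ Ψ') (f : A) :
    Ψ' f = Ψ f + t * Ψ (X f) := by
  have := (h f).unique hF
    (isSum_of_eq_zero 2 (expTerm_of_sq (ht.sq rfl) X Ψ f) (expTerm_mem hF ht.mem X Ψ f) hF)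
  simpa [sum_range_succ] using this

/-- Algebraic identities pass from the terms to the sums by uniqueness of limits. In the odd case `t
* t = 0` reduces the series to `Ψ f + t Ψ(X f)`, and the twisted Leibniz rule is compensated by `a t
= t σ(a)`. The filtration is preserved because each factor `t` raises it by one while each `X`
lowers it by at most one. -/
theorem exists_isExp (hF : IsCompleteFiltration F) {σ : A →+* A}
    (hσ : ∀ k, ∀ a ∈ F k, σ a ∈ F k) (hσc : ∀ (c : ℂ) a, σ (c • a) = c • σ a)
    {p : ZMod 2} {t : A} (ht : IsParam F σ p t)
    {X : Module.End ℂ A} (hX : IsDer F σ p X) {Ψ : A →ₐ[ℂ] A} (hΨ : IsGradedLocal F σ Ψ) :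
    ∃ Ψ', IsGradedLocal F σ Ψ' ∧ IsExp F t X Ψ Ψ' := by
  choose e he using fun f => hF.exists_sum _ (expTerm_mem hF ht.mem X Ψ f)
  have he' : ∀ f, IsSum F (expTerm t X Ψ f) (e f) := he
  have e_add : ∀ f g, e (f + g) = e f + e g := fun f g => by
    refine (he' (f + g)).unique hF ?_
    have := (he' f).add (he' g)
    convert this using 2 with k
    simp only [expTerm, map_add, mul_add, smul_add]
  have e_smul : ∀ (c : ℂ) f, e (c • f) = c • e f := fun c f => by
    refine (he' (c • f)).unique hF ?_
    have := (he' f).smul c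
    convert this using 2 with k
    simp only [expTerm, map_smul, mul_smul_comm, smul_comm c]
  have e_one : e 1 = 1 := by
    have h1 : (X ^ 1) (1 : A) = 0 := by rw [pow_one, hX.map_one]
    have := (he' 1).unique hF
      (isSum_of_eq_zero 1 (expTerm_of_eq_zero t X Ψ h1) (expTerm_mem hF ht.mem X Ψ 1) hF)
    simpa using this
  have e_mul : ∀ f g, e (f * g) = e f * e g := fun f g => by
    rcases FormalSuper.zmod_two_cases p with rfl | rfl
    · refine (he' (f * g)).unique hF ?_
      have := (he' f).mul hF (he' g)
      convert this using 2 with k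
      exact expTerm_mul ht hX Ψ f g k
    · have e_eq : ∀ f, e f = Ψ f + t * Ψ (X f) := fun f => by
        have := (he' f).unique hF
          (isSum_of_eq_zero 2 (expTerm_of_sq (ht.sq rfl) X Ψ f) (expTerm_mem hF ht.mem X Ψ f) hF)
        simpa [sum_range_succ] using this
      have hc : ∀ a, t * σ a = a * t := fun a => by simpa using (ht.mul_comm a).symm
      have h0 : t * Ψ (X f) * (t * Ψ (X g)) = 0 := by
        rw [mul_assoc, ← mul_assoc (Ψ (X f)), ht.mul_comm, ← mul_assoc, ← mul_assoc, ht.sq rfl,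
          zero_mul, zero_mul]
      rw [e_eq, e_eq, e_eq, hX.leibniz, map_mul, map_add, map_mul, map_mul, twist_one, hΨ.comm,
        mul_add t, ← mul_assoc t (σ _), hc, add_mul, mul_add, mul_add, h0]
      noncomm_ring
  let Ψ' : A →ₐ[ℂ] A := AlgHom.ofLinearMap ⟨⟨e, e_add⟩, e_smul⟩ e_one e_mul
  refine ⟨Ψ', ⟨fun k a ha => ?_, fun a => ?_⟩, he'⟩
  · have h1 := he' a k
    have h2 : ∑ j ∈ range k, expTerm t X Ψ a j ∈ F k := by
      have hXa : ∀ j, j ≤ k → (X ^ j) a ∈ F (k - j) := by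
        intro j
        induction j with
        | zero => intro _; exact ha
        | succ j ih =>
          intro hj
          rw [pow_succ', Module.End.mul_apply]
          refine hX.lowers _ _ ?_
          rw [show k - (j + 1) + 1 = k - j by omega]
          exact ih (by omega)
      refine Submodule.sum_mem _ fun j hj => Submodule.smul_mem _ _ ?_
      have hj := (mem_range.1 hj).le
      have := hF.mul_mem (hF.pow_mem ht.mem j) (hΨ.map_mem _ _ (hXa j hj))
      rwa [Nat.add_sub_cancel' hj] at this
    have := Submodule.add_mem _ h1 h2
    rwa [sub_add_cancel] at this
  · refine (he' (σ a)).unique hF ?_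
    have : IsSum F (fun k => σ (expTerm t X Ψ a k)) (σ (Ψ' a)) :=
      (he' a).map σ.toAddMonoidHom hσ
    convert this using 2 with k
    -- The signs produced by `t ^ k` and by `X ^ k` are the same power of `±1`, so their product is
    -- `1`.
    have hs : ∀ c, FormalSuper.sgn 1 p * (FormalSuper.sgn 1 p * c) = c := fun c => by
      rcases FormalSuper.zmod_two_cases p with rfl | rfl
      · simp [FormalSuper.sgn_zero_right]
      · simp [FormalSuper.sgn_one_one]
    have hXk : ∀ k a, σ ((X ^ k) a) = FormalSuper.sgn 1 p ^ k • (X ^ k) (σ a) := by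
      intro k
      induction k with
      | zero => simp
      | succ k ih =>
        intro a
        rw [pow_succ', Module.End.mul_apply, hX.parity_apply, ih, map_smul, smul_smul,
          Module.End.mul_apply, pow_succ']
    change expTerm t X Ψ (σ a) k = σ (expTerm t X Ψ a k)
    rw [expTerm, expTerm, hσc, map_mul, map_pow, ht.parity_apply, ← hΨ.comm, hXk, map_smul,
      smul_pow, smul_mul_smul_comm, ← mul_pow]
    have := hs 1
    rw [mul_one] at this
    rw [this, one_pow, one_smul]

end FilteredSuper


/-! ### Ideals under exponentials, unipotent endomorphisms and composites of flows. -/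

namespace FilteredSuper

open Finset

variable {A : Type*} [Ring A] [Algebra ℂ A] {F : ℕ → Submodule ℂ A} {σ : A →+* A}

theorem IsExp.sub_mem {t : A} {X : Module.End ℂ A} {Ψ Ψ' : A →ₐ[ℂ] A} (h : IsExp F t X Ψ Ψ')
    (f : A) : Ψ' f - (Ψ f + t * Ψ (X f)) ∈ F 2 := by
  simpa [sum_range_succ] using h f 2

/-- The two-sided ideal `I` is generated, as a right ideal, by the homogeneous elements `y k`. -/
structure IsGeneratedBy {κ : Type*} [Fintype κ] (σ : A →+* A) (I : TwoSidedIdeal A)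
    (q : κ → ZMod 2) (y : κ → A) : Prop where
  mul_comm : ∀ k a, a * y k = y k * twist σ (q k) a
  mem_iff : ∀ a, a ∈ I ↔ ∃ h : κ → A, a = ∑ k, y k * h k

theorem twist_mem (hσ : ∀ k, ∀ a ∈ F k, σ a ∈ F k) (p : ZMod 2) {k : ℕ} {a : A} (ha : a ∈ F k) :
    twist σ p a ∈ F k := by
  rcases FormalSuper.zmod_two_cases p with rfl | rfl
  · simpa using ha
  · simpa using hσ k a ha

variable {κ : Type*} [Fintype κ]

theorem smul_mem_twoSidedIdeal {I : TwoSidedIdeal A} (c : ℂ) {a : A} (ha : a ∈ I) :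
    c • a ∈ I := by
  rw [Algebra.smul_def]
  exact TwoSidedIdeal.mul_mem_left _ _ _ ha

/-- A form of closedness of a finitely generated ideal: each `h k` is expanded in the generators,
the powers of `t` are moved past them at the cost of a twist, and the coefficients of each generator
are summed separately. -/
theorem IsGeneratedBy.isSum_mem (hF : IsCompleteFiltration F)
    (hσ : ∀ k, ∀ a ∈ F k, σ a ∈ F k) {I : TwoSidedIdeal A} {q : κ → ZMod 2} {y : κ → A}
    (hI : IsGeneratedBy σ I q y) {t : A} (ht : t ∈ F 1) {c : ℕ → ℂ} {h : ℕ → A}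
    (hh : ∀ k, h k ∈ I) {S : A} (hS : IsSum F (fun k => c k • (t ^ k * h k)) S) : S ∈ I := by
  choose g hg using fun k => (hI.mem_iff (h k)).1 (hh k)
  have hm : ∀ u k, c k • (twist σ (q u) t ^ k * g k u) ∈ F k := fun u k =>
    Submodule.smul_mem _ _ (hF.mul_mem_right _ (hF.pow_mem (twist_mem hσ _ ht) k))
  choose T hT using fun u => hF.exists_sum _ (hm u)
  refine (hI.mem_iff S).2 ⟨T, hS.unique hF ?_⟩
  have : IsSum F _ (∑ u, y u * T u) :=
    IsSum.finset_sum univ fun u _ => IsSum.mul_left hF (y u) (hT u)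
  convert this using 2 with k
  rw [hg k, mul_sum, smul_sum]
  refine sum_congr rfl fun u _ => ?_
  rw [← mul_assoc, hI.mul_comm, map_pow, mul_assoc, mul_smul_comm]

theorem IsExp.mem_of_stable (hF : IsCompleteFiltration F)
    (hσ : ∀ k, ∀ a ∈ F k, σ a ∈ F k) {I : TwoSidedIdeal A} {q : κ → ZMod 2} {y : κ → A}
    (hI : IsGeneratedBy σ I q y) {t : A} (ht : t ∈ F 1) {X : Module.End ℂ A} {Ψ Ψ' : A →ₐ[ℂ] A}
    (h : IsExp F t X Ψ Ψ') {K : Set A} (hX : ∀ f ∈ K, X f ∈ K) (hK : ∀ f ∈ K, Ψ f ∈ I) :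
    ∀ f ∈ K, Ψ' f ∈ I := by
  intro f hf
  refine hI.isSum_mem hF hσ ht (fun k => hK _ ?_) (h f)
  induction k with
  | zero => simpa using hf
  | succ k ih => rw [pow_succ', Module.End.mul_apply]; exact hX _ ih

theorem IsDer.pow_apply_eq_zero {p : ZMod 2} {w : Module.End ℂ A} (hw : IsDer F σ p w) {t : A}
    (ht : w t = 0) (k : ℕ) : w (t ^ k) = 0 := by
  induction k with
  | zero => rw [pow_zero, hw.map_one]
  | succ k ih => rw [pow_succ, hw.leibniz, ih, ht, zero_mul, mul_zero, add_zero]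

theorem IsExp.der_apply_eq_zero (hF : IsCompleteFiltration F) {p : ZMod 2} {w : Module.End ℂ A}
    (hw : IsDer F σ p w) {t : A} {X : Module.End ℂ A} {Ψ Ψ' : A →ₐ[ℂ] A} (h : IsExp F t X Ψ Ψ')
    (ht : w t = 0) (hΨ : ∀ f, w (Ψ f) = 0) (f : A) : w (Ψ' f) = 0 := by
  refine hF.eq_zero fun K => ?_
  -- A derivation loses one step of the filtration, so the remainder is taken one step further.
  have := hw.lowers _ _ (h f (K + 1))
  have h0 : ∀ k, w (expTerm t X Ψ f k) = 0 := fun k => by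
    rw [expTerm, map_smul, hw.leibniz, hw.pow_apply_eq_zero ht, hΨ, zero_mul, mul_zero, add_zero,
      smul_zero]
  rwa [map_sub, map_sum, sum_eq_zero fun k _ => h0 k, sub_zero] at this

theorem IsDer.pow_succ_apply {w : Module.End ℂ A} (hw : IsDer F σ 0 w) {t : A}
    (h1 : w t = 1) (k : ℕ) : w (t ^ (k + 1)) = (k + 1 : ℂ) • t ^ k := by
  induction k with
  | zero => simp [h1]
  | succ k ih =>
    rw [pow_succ, hw.leibniz, ih, h1, twist_zero, RingHom.id_apply, mul_one, smul_mul_assoc,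
      ← pow_succ]
    rw [Nat.cast_succ, add_smul (k + 1 : ℂ) 1, one_smul]

/-- This is `d/dt exp(tX) = exp(tX) X`, with `w` in the role of `d/dt`; differentiating shifts the
series by one term. -/
theorem IsExp.der_apply (hF : IsCompleteFiltration F) {w : Module.End ℂ A}
    (hw : IsDer F σ 0 w) {t : A} (ht : IsParam F σ 0 t) {X : Module.End ℂ A} {Ψ Ψ' : A →ₐ[ℂ] A}
    (h : IsExp F t X Ψ Ψ') (h1 : w t = 1) (hΨ : ∀ f, w (Ψ f) = 0) (f : A) :
    w (Ψ' f) = Ψ' (X f) := by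
  have : IsSum F (expTerm t X Ψ (X f)) (w (Ψ' f)) := fun K => by
    have := hw.lowers _ _ (h f (K + 1))
    rw [map_sub, map_sum, sum_range_succ', expTerm_zero, hΨ, add_zero] at this
    convert this using 3 with k
    rw [expTerm, expTerm, map_smul, hw.leibniz, hΨ, mul_zero, add_zero, hw.pow_succ_apply h1,
      smul_mul_assoc, smul_smul, pow_succ, Module.End.mul_apply]
    congr 1
    have : (k.factorial : ℂ) ≠ 0 := by exact_mod_cast k.factorial_ne_zero
    have : (k + 1 : ℂ) ≠ 0 := by exact_mod_cast k.succ_ne_zero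
    rw [Nat.factorial_succ]
    push_cast
    field_simp
  exact this.unique hF (h _)

theorem isGradedLocal_id : IsGradedLocal F σ (AlgHom.id ℂ A) := ⟨fun _ _ h => h, fun _ => rfl⟩

/-- Taylor coefficients with respect to `t` are recovered by applying `v ^ k` and then setting `t =
0`. Both operations preserve `I`, so membership of the sum in `I` forces membership of every
coefficient. -/
theorem IsExp.apply_mem_of_mem (hF : IsCompleteFiltration F)
    (hσ : ∀ k, ∀ a ∈ F k, σ a ∈ F k) (hσc : ∀ (c : ℂ) a, σ (c • a) = c • σ a)
    {I : TwoSidedIdeal A} {q : κ → ZMod 2} {y : κ → A}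
    (hI : IsGeneratedBy σ I q y) {p : ZMod 2} {t : A} (ht : IsParam F σ p t)
    {X v : Module.End ℂ A} (hv : IsDer F σ p v) {Ψ Ψ' : A →ₐ[ℂ] A}
    (h : IsExp F t X Ψ Ψ') (h1 : v t = 1) (hΨ : ∀ f, v (Ψ f) = 0) (hvI : ∀ a ∈ I, v a ∈ I)
    {f : A} (hf : Ψ' f ∈ I) (k : ℕ) (hk : p = 1 → k ≤ 1) : Ψ ((X ^ k) f) ∈ I := by
  rcases FormalSuper.zmod_two_cases p with rfl | rfl
  -- `P = exp(-t v)` is the substitution `t = 0`: it kills `t` and fixes the image of `Ψ`, on which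
  -- `v` vanishes.
  · obtain ⟨P, hP, hPe⟩ := exists_isExp hF hσ hσc ht.neg hv (isGradedLocal_id (F := F) (σ := σ))
    have hPt : P t = 0 := by
      have : (v ^ 2) t = 0 := by rw [pow_two, Module.End.mul_apply, h1, hv.map_one]
      rw [hPe.apply_of_eq_zero hF ht.neg.mem this]
      simp [sum_range_succ, h1]
    have hPΨ : ∀ f, P (Ψ f) = Ψ f := fun f => by
      have : (v ^ 1) (Ψ f) = 0 := by rw [pow_one, hΨ]
      rw [hPe.apply_of_eq_zero hF ht.neg.mem this]
      simp
    have hPΨ' : ∀ f, P (Ψ' f) = Ψ f := fun f => by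
      have h2 : IsSum F (fun k => P (expTerm t X Ψ f k)) (P (Ψ' f)) :=
        (h f).map (P : A →+ A) hP.map_mem
      have h3 := isSum_of_eq_zero (F := F) (s := fun k => P (expTerm t X Ψ f k)) 1
        (fun k hk => by
          rw [expTerm, map_smul, map_mul, map_pow, hPt, zero_pow (by omega), zero_mul, smul_zero])
        (fun k => hP.map_mem _ _ (expTerm_mem hF ht.mem X Ψ f k)) hF
      rw [h2.unique hF h3]
      simp [hPΨ]
    have hPI : ∀ a ∈ I, P a ∈ I :=
      hPe.mem_of_stable hF hσ hI ht.neg.mem (K := (I : Set A)) hvI (fun _ ha => ha)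
    have key : Ψ' ((X ^ k) f) ∈ I := by
      clear hk
      induction k with
      | zero => simpa using hf
      | succ k ih =>
        rw [pow_succ', Module.End.mul_apply, ← h.der_apply hF hv ht h1 hΨ]
        exact hvI _ ih
    rw [← hPΨ']
    exact hPI _ key
  · have e := h.apply_of_odd hF ht f
    have e1 : v (Ψ' f) = Ψ (X f) := by
      rw [e, map_add, hΨ, hv.leibniz, h1, hΨ, mul_zero, zero_add, add_zero, one_mul]
    have h2 : Ψ (X f) ∈ I := e1 ▸ hvI _ hf
    have hk := hk rfl
    interval_cases k
    · have h3 := TwoSidedIdeal.sub_mem _ hf (TwoSidedIdeal.mul_mem_left _ t _ h2)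
      rw [e, add_sub_cancel_right] at h3
      simpa using h3
    · simpa using h2

/-- An endomorphism which is the identity on the associated graded space is bijective. -/
theorem bijective_of_unipotent (hF : IsCompleteFiltration F) (Ψ : A →ₗ[ℂ] A)
    (h : ∀ k, ∀ a ∈ F k, Ψ a - a ∈ F (k + 1)) : Function.Bijective Ψ := by
  constructor
  · rw [injective_iff_map_eq_zero]
    intro a ha
    refine hF.eq_zero fun k => ?_
    induction k with
    | zero => rw [hF.zero_eq_top]; trivial
    | succ k ih =>
      have := h k a ih
      rwa [ha, zero_sub, neg_mem_iff] at this
  · intro g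
    -- Neumann series: the preimage is the sum of `(1 - Ψ)^k g`, and applying `Ψ` to its partial
    -- sums telescopes.
    let s : ℕ → A := fun k => (fun a => a - Ψ a)^[k] g
    have hs : ∀ k, s (k + 1) = s k - Ψ (s k) := fun k => Function.iterate_succ_apply' _ _ _
    have hm : ∀ k, s k ∈ F k := by
      intro k
      induction k with
      | zero => rw [hF.zero_eq_top]; trivial
      | succ k ih =>
        rw [hs, ← neg_sub]
        exact neg_mem (h k _ ih)
    obtain ⟨S, hS⟩ := hF.exists_sum s hm
    refine ⟨S, hF.eq_of_sub_mem fun K => ?_⟩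
    have e : ∑ k ∈ range K, Ψ (s k) = g - s K := by
      induction K with
      | zero => simp [s]
      | succ K ih => rw [sum_range_succ, ih, hs]; abel
    have h1 : Ψ (S - ∑ k ∈ range K, s k) ∈ F K := by
      have := add_mem (hF.anti (Nat.le_succ K) (h K _ (hS K))) (hS K)
      rwa [sub_add_cancel] at this
    rw [map_sub, map_sum, e] at h1
    have := sub_mem h1 (hm K)
    convert this using 1
    abel

/-- This gives the continuity of the inverse automorphism. -/
theorem mem_of_apply_mem_of_unipotent (hF : IsCompleteFiltration F) (Ψ : A →ₗ[ℂ] A)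
    (h : ∀ k, ∀ a ∈ F k, Ψ a - a ∈ F (k + 1)) {k : ℕ} {a : A} (ha : Ψ a ∈ F k) : a ∈ F k := by
  have : ∀ j, j ≤ k → a ∈ F j := by
    intro j
    induction j with
    | zero => intro _; rw [hF.zero_eq_top]; trivial
    | succ j ih =>
      intro hj
      have h1 := h j a (ih (by omega))
      have := sub_mem (hF.anti hj ha) h1
      rwa [sub_sub_cancel] at this
  exact this k le_rfl

/-- Homogeneous parameters `t i` and derivations `v i` with `v i (t j) = δ_{ij}`, and further
derivations `X i` of the same parities. -/
structure Frame (F : ℕ → Submodule ℂ A) (σ : A →+* A) (ι : Type*) [DecidableEq ι] where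
  par : ι → ZMod 2
  t : ι → A
  v : ι → Module.End ℂ A
  X : ι → Module.End ℂ A
  param : ∀ i, IsParam F σ (par i) (t i)
  der_v : ∀ i, IsDer F σ (par i) (v i)
  der_X : ∀ i, IsDer F σ (par i) (X i)
  v_t : ∀ i j, v i (t j) = if i = j then 1 else 0

/-- `P` holds for all images of `f` under the ordered monomials in the `X i` for `i` in the list,
the odd ones occurring with exponents at most one. -/
def OrdVanish {R M ι : Type*} [Monoid R] [MulAction R M] (par : ι → ZMod 2) (X : ι → R)
    (P : M → Prop) : List ι → M → Prop
  | [], f => P f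
  | i :: l, f => ∀ k : ℕ, (par i = 1 → k ≤ 1) → OrdVanish par X P l ((X i ^ k) • f)

theorem OrdVanish.imp {R M ι : Type*} [Monoid R] [MulAction R M] {par : ι → ZMod 2} {X : ι → R}
    {P Q : M → Prop} (hPQ : ∀ f, P f → Q f) {l : List ι} :
    ∀ {f : M}, OrdVanish par X P l f → OrdVanish par X Q l f := by
  induction l with
  | nil => exact fun h => hPQ _ h
  | cons i l ih => exact fun h k hk => ih (h k hk)

theorem OrdVanish.base {R M ι : Type*} [Monoid R] [MulAction R M] {par : ι → ZMod 2} {X : ι → R}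
    {P : M → Prop} {l : List ι} : ∀ {f : M}, OrdVanish par X P l f → P f := by
  induction l with
  | nil => exact fun h => h
  | cons i l ih => exact fun h => ih (by simpa using h 0 (by simp))

variable {ι : Type*} [DecidableEq ι]

/-- `E` is the composite of the `exp(-t_i v_i)`. When every `v_i g` is a constant, each exponential
series stops after its linear term. For a list running once through all indices, `E` kills all the
`t_i`. -/
theorem Frame.exists_projection (hF : IsCompleteFiltration F)
    (hσ : ∀ k, ∀ a ∈ F k, σ a ∈ F k) (hσc : ∀ (c : ℂ) a, σ (c • a) = c • σ a)
    (B : Frame F σ ι) (l : List ι) :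
    ∃ E : A →ₐ[ℂ] A, IsGradedLocal F σ E ∧
      ∀ g : A, (∀ i, ∃ c : ℂ, B.v i g = algebraMap ℂ A c) →
        E g = g - (l.map fun i => B.t i * B.v i g).sum := by
  induction l with
  | nil => exact ⟨AlgHom.id ℂ A, isGradedLocal_id, fun g _ => by simp⟩
  | cons i l ih =>
    obtain ⟨E, hE, hg⟩ := ih
    obtain ⟨E', hE', he⟩ := exists_isExp hF hσ hσc (B.param i).neg (B.der_v i) hE
    refine ⟨E', hE', fun g h => ?_⟩
    obtain ⟨c, hc⟩ := h i
    have h2 : (B.v i ^ 2) g = 0 := by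
      rw [pow_two, Module.End.mul_apply, hc, (B.der_v i).map_algebraMap]
    rw [he.apply_of_eq_zero hF (B.param i).neg.mem h2]
    simp only [sum_range_succ, range_zero, sum_empty, zero_add, expTerm_zero, expTerm_one, hg g h,
      List.map_cons, List.sum_cons, hc, AlgHom.commutes]
    noncomm_ring

/-- The exponentials `exp(t_i X_i)` are composed one index at a time. The first-order expansion is
for unipotence. The vanishing of `v i` for indices not yet used is what `IsExp.apply_mem_of_mem`
requires at the next index. The last two clauses are the two inclusions between the preimage of `I`
and the functions whose Taylor coefficients lie in `I`. -/
theorem Frame.exists_flow (hF : IsCompleteFiltration F)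
    (hσ : ∀ k, ∀ a ∈ F k, σ a ∈ F k) (hσc : ∀ (c : ℂ) a, σ (c • a) = c • σ a)
    {I : TwoSidedIdeal A} {q : κ → ZMod 2} {y : κ → A} (hI : IsGeneratedBy σ I q y)
    (B : Frame F σ ι) (hvI : ∀ i, ∀ a ∈ I, B.v i a ∈ I) {E : A →ₐ[ℂ] A}
    (hE : IsGradedLocal F σ E) (hvE : ∀ i f, B.v i (E f) = 0) (l : List ι) (hl : l.Nodup) :
    ∃ Ψ : A →ₐ[ℂ] A, IsGradedLocal F σ Ψ ∧
      (∀ f, Ψ f - (E f + (l.map fun i => B.t i * E (B.X i f)).sum) ∈ F 2) ∧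
      (∀ i ∉ l, ∀ f, B.v i (Ψ f) = 0) ∧
      (∀ K : Set A, (∀ i, ∀ f ∈ K, B.X i f ∈ K) → (∀ f ∈ K, E f ∈ I) → ∀ f ∈ K, Ψ f ∈ I) ∧
      (∀ f, Ψ f ∈ I → OrdVanish B.par B.X (fun g => E g ∈ I) l f) := by
  induction l with
  | nil =>
    exact ⟨E, hE, fun f => by simp, fun i _ => hvE i, fun K _ h => h, fun f h => h⟩
  | cons i l ih =>
    obtain ⟨Ψ, hΨ, h2, hv, hK, hord⟩ := ih (List.nodup_cons.1 hl).2
    obtain ⟨Ψ', hΨ', he⟩ := exists_isExp hF hσ hσc (B.param i) (B.der_X i) hΨ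
    have hil := (List.nodup_cons.1 hl).1
    refine ⟨Ψ', hΨ', fun f => ?_, fun j hj f => ?_, fun K hX hEK => ?_, fun f hf k hk => ?_⟩
    · have e1 : Ψ (B.X i f) - E (B.X i f) ∈ F 1 := by
        have h3 := hF.anti (by omega : 1 ≤ 2) (h2 (B.X i f))
        have h4 : (l.map fun j => B.t j * E (B.X j (B.X i f))).sum ∈ F 1 :=
          list_sum_mem fun a ha => by
            obtain ⟨j, _, rfl⟩ := List.mem_map.1 ha
            exact hF.mul_mem_right _ (B.param j).mem
        have := add_mem h3 h4
        rwa [sub_add_eq_sub_sub, sub_add_cancel] at this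
      have e2 := hF.mul_mem (B.param i).mem e1
      have := add_mem (add_mem (he.sub_mem f) e2) (h2 f)
      rw [List.map_cons, List.sum_cons]
      convert this using 1
      rw [mul_sub]
      abel
    · rw [List.mem_cons, not_or] at hj
      refine he.der_apply_eq_zero hF (B.der_v j) ?_ (hv j hj.2) f
      rw [B.v_t, if_neg hj.1]
    · exact he.mem_of_stable hF hσ hI (B.param i).mem (hX i) (hK K hX hEK)
    · refine hord _ (he.apply_mem_of_mem hF hσ hσc hI (B.param i) (B.der_v i) ?_ (hv i hil)
        (hvI i) hf k hk)
      rw [B.v_t, if_pos rfl]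

/-- The elements killed by `D ∘ Ψ` include the subalgebra generated by `s`, by the Leibniz rule, and
this subalgebra is dense. -/
theorem IsDer.comp_eq_zero (hF : IsCompleteFiltration F) {s : Set A}
    (hs : ∀ k f, ∃ a ∈ Algebra.adjoin ℂ s, f - a ∈ F k) {p : ZMod 2} {D : Module.End ℂ A}
    (hD : IsDer F σ p D) {Ψ : A →ₐ[ℂ] A} (hΨ : IsGradedLocal F σ Ψ)
    (h : ∀ a ∈ s, D (Ψ a) = 0) (f : A) : D (Ψ f) = 0 := by
  have key : ∀ a ∈ Algebra.adjoin ℂ s, D (Ψ a) = 0 := fun a ha => by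
    induction ha using Algebra.adjoin_induction with
    | mem x hx => exact h x hx
    | algebraMap r => rw [AlgHom.commutes, hD.map_algebraMap]
    | add x y _ _ hx hy => rw [map_add, map_add, hx, hy, add_zero]
    | mul x y _ _ hx hy => rw [map_mul, hD.leibniz, hx, hy, zero_mul, mul_zero, add_zero]
  refine hF.eq_zero fun k => ?_
  obtain ⟨a, ha, hfa⟩ := hs (k + 1) f
  have := hD.lowers _ _ (hΨ.map_mem _ _ hfa)
  rwa [map_sub, map_sub, key a ha, sub_zero] at this

end FilteredSuper

/-! ### Reordering words in a Lie superalgebra of operators (Poincaré–Birkhoff–Witt). -/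

namespace FilteredSuper

open FormalSuper

variable {R : Type*} [Ring R] [Algebra ℂ R]

/-- The span of the identity and of a family of operators. -/
def oneSup (Lp : ZMod 2 → Submodule ℂ R) : Submodule ℂ R :=
  1 ⊔ (Lp 0 ⊔ Lp 1)

variable {Lp : ZMod 2 → Submodule ℂ R}

theorem one_le_oneSup : 1 ≤ oneSup Lp := le_sup_left

theorem le_oneSup (p : ZMod 2) : Lp p ≤ oneSup Lp := by
  rcases zmod_two_cases p with rfl | rfl
  · exact le_sup_left.trans le_sup_right
  · exact le_sup_right.trans le_sup_right

theorem oneSup_pow_mono : Monotone fun k => oneSup Lp ^ k :=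
  pow_right_mono₀ one_le_oneSup

theorem list_prod_mem_pow {w : List R} (hw : ∀ a ∈ w, ∃ p, a ∈ Lp p) :
    w.prod ∈ oneSup Lp ^ w.length := by
  induction w with
  | nil => simpa using Submodule.mem_one.2 ⟨1, map_one (algebraMap ℂ R)⟩
  | cons a w ih =>
    rw [List.forall_mem_cons] at hw
    obtain ⟨⟨p, hp⟩, hw⟩ := hw
    rw [List.prod_cons, List.length_cons, pow_succ']
    exact Submodule.mul_mem_mul (le_oneSup p hp) (ih hw)

/-- The family `Lp` is closed under the superbracket. -/
def IsBracketClosed (Lp : ZMod 2 → Submodule ℂ R) : Prop :=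
  ∀ p q, ∀ X ∈ Lp p, ∀ Y ∈ Lp q, X * Y - sgn p q • (Y * X) ∈ Lp (p + q)

/-- Homogeneous letters of a word may be permuted up to sign and shorter words. -/
theorem exists_smul_sub_mem_of_perm (hL : IsBracketClosed Lp) {w w' : List R}
    (h : w.Perm w') (hw : ∀ a ∈ w, ∃ p, a ∈ Lp p) :
    ∃ c : ℂ, w.prod - c • w'.prod ∈ oneSup Lp ^ (w.length - 1) := by
  induction h with
  | nil => exact ⟨1, by simp⟩
  | cons x h ih =>
    rename_i l l'
    rw [List.forall_mem_cons] at hw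
    rcases l with _ | ⟨y, l⟩
    · rw [List.nil_perm.1 h]
      exact ⟨1, by simp⟩
    · obtain ⟨c, hc⟩ := ih hw.2
      obtain ⟨p, hp⟩ := hw.1
      refine ⟨c, ?_⟩
      rw [List.prod_cons, List.prod_cons (a := x), ← mul_smul_comm, ← mul_sub]
      have := Submodule.mul_mem_mul (le_oneSup p hp) hc
      rw [← pow_succ'] at this
      simpa using this
  | swap x y l =>
    obtain ⟨p, hp⟩ := hw y (by simp)
    obtain ⟨q, hq⟩ := hw x (by simp)
    -- The error of the swap is a superbracket, which counts as one letter in place of two.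
    refine ⟨sgn p q, ?_⟩
    have h1 := list_prod_mem_pow (w := l) fun a ha => hw a (by simp [ha])
    have := Submodule.mul_mem_mul (le_oneSup _ (hL p q y hp x hq)) h1
    rw [← pow_succ'] at this
    rw [sub_mul, smul_mul_assoc, mul_assoc, mul_assoc] at this
    simp only [List.prod_cons]
    exact this
  | trans h h' ih ih' =>
    obtain ⟨c, hc⟩ := ih hw
    obtain ⟨c', hc'⟩ := ih' fun a ha => hw a (h.mem_iff.2 ha)
    refine ⟨c * c', ?_⟩
    rw [← h.length_eq] at hc'
    have := add_mem hc (Submodule.smul_mem _ c hc')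
    rwa [smul_sub, smul_smul, sub_add_sub_cancel] at this

open scoped Pointwise in
theorem exists_list_of_mem_pow {M : Type*} [Monoid M] {G : Set M} {k : ℕ} {x : M}
    (hx : x ∈ (insert 1 G) ^ k) :
    ∃ w : List M, (∀ a ∈ w, a ∈ G) ∧ w.length ≤ k ∧ w.prod = x := by
  induction k generalizing x with
  | zero => exact ⟨[], by simp, by simp, by simpa using hx.symm⟩
  | succ k ih =>
    rw [pow_succ', Set.mem_mul] at hx
    obtain ⟨a, ha, b, hb, rfl⟩ := hx
    obtain ⟨w, hw, hl, rfl⟩ := ih hb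
    rcases ha with rfl | ha
    · exact ⟨w, hw, by omega, by simp⟩
    · exact ⟨a :: w, List.forall_mem_cons.2 ⟨ha, hw⟩, by simpa using hl, by simp⟩

end FilteredSuper

namespace FilteredSuper

open FormalSuper

variable {R : Type*} [Ring R] [Algebra ℂ R] {Lp : ZMod 2 → Submodule ℂ R}
  {A : Type*} [AddCommGroup A] [Module ℂ A] [Module R A] [IsScalarTower ℂ R A]
  {ι : Type*} {par : ι → ZMod 2} {X : ι → R}

/-- Induction on the list of allowed letters. Modulo words of length at most `j`, which vanish on
`f` by hypothesis, all occurrences of the first letter are gathered at the right, where they act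
first; the rest is a word in the remaining letters applied to `X i ^ c • f`. -/
theorem OrdVanish.word_apply [DecidableEq ι] (hL : IsBracketClosed Lp) (hX : ∀ i, X i ∈ Lp (par i))
    (ev : A →ₗ[ℂ] ℂ) (l : List ι) : ∀ (f : A) (j : ℕ),
      OrdVanish par X (fun g => ev g = 0) l f → (∀ T ∈ oneSup Lp ^ j, ev (T • f) = 0) →
      ∀ w : List ι, (∀ i ∈ w, i ∈ l) → w.length ≤ j + 1 → ev ((w.map X).prod • f) = 0 := by
  induction l with
  | nil =>
    intro f j hf _ w hw _
    rw [List.eq_nil_iff_forall_not_mem.2 fun i hi => List.not_mem_nil (hw i hi)]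
    rw [List.map_nil, List.prod_nil, one_smul]
    exact hf
  | cons i l ih =>
    intro f j hf hT w hw hlen
    have hmem : ∀ w : List ι, ∀ a ∈ w.map X, ∃ p, a ∈ Lp p := fun w a ha => by
      obtain ⟨i, _, rfl⟩ := List.mem_map.1 ha
      exact ⟨_, hX i⟩
    set w' := w.filter (fun x => !(x == i)) with hw'
    set c := w.count i with hc
    have hp : w.Perm (w' ++ List.replicate c i) := by
      rw [hc, ← List.filter_beq]
      exact ((List.perm_append_comm).trans (List.filter_append_perm (fun x => x == i) w)).symm
    have hlen' : w'.length + c = w.length := by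
      rw [hp.length_eq, List.length_append, List.length_replicate]
    obtain ⟨a, ha⟩ := exists_smul_sub_mem_of_perm hL (hp.map X) (hmem w)
    rw [List.length_map] at ha
    have ha' := hT _ (oneSup_pow_mono (by omega : w.length - 1 ≤ j) ha)
    rw [sub_smul, map_sub, smul_assoc, map_smul ev, sub_eq_zero] at ha'
    rw [ha', List.map_append, List.prod_append, List.map_replicate, List.prod_replicate]
    suffices h : ev (((w'.map X).prod * X i ^ c) • f) = 0 by rw [h, smul_zero]
    by_cases hci : par i = 1 → c ≤ 1
    · have h1 := hf c hci
      -- If `w'` is nonempty then `c ≤ j`, so the truncated difference `j - c` used below is a true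
      -- one.
      rcases Nat.eq_zero_or_pos w'.length with h0 | h0
      · rw [List.length_eq_zero_iff.1 h0]
        simpa using h1.base
      · rw [mul_smul]
        refine ih _ (j - c) h1 (fun T hT' => ?_) w' (fun x hx => ?_) (by omega)
        · rw [← mul_smul]
          refine hT _ ?_
          have := Submodule.mul_mem_mul hT'
            (Submodule.pow_mem_pow _ (le_oneSup _ (hX i)) c)
          rwa [← pow_add, Nat.sub_add_cancel (by omega)] at this
        · obtain ⟨hx, hxi⟩ := List.mem_filter.1 hx
          have := hw x hx
          simp only [List.mem_cons] at this
          simpa [show x ≠ i by simpa using hxi] using this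
    · rw [Classical.not_imp, not_le] at hci
      obtain ⟨hpi, hc2⟩ := hci
      -- The square of an odd letter is half its superbracket with itself, hence counts as a single
      -- letter; a repeated odd letter therefore shortens the word.
      have hsq : X i ^ 2 ∈ oneSup Lp := by
        have h1 := hL _ _ _ (hX i) _ (hX i)
        rw [hpi, sgn_one_one, neg_smul, one_smul, sub_neg_eq_add, ← pow_two,
          ← two_smul ℂ (X i ^ 2)] at h1
        have := Submodule.smul_mem _ (2⁻¹ : ℂ) (le_oneSup _ h1)
        rwa [smul_smul, inv_mul_cancel₀ two_ne_zero, one_smul] at this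
      refine hT _ ?_
      obtain ⟨e, he⟩ := Nat.exists_eq_add_of_le hc2
      have he : c = 2 + e := by omega
      have h1 := list_prod_mem_pow (hmem w')
      rw [List.length_map] at h1
      have := Submodule.mul_mem_mul h1 (Submodule.mul_mem_mul hsq
        (Submodule.pow_mem_pow _ (le_oneSup _ (hX i)) e))
      rw [← pow_succ', ← pow_add] at this
      rw [he, pow_add]
      exact oneSup_pow_mono (by omega) this

/-- A functional which vanishes on ordered monomials vanishes on all words. -/
theorem OrdVanish.all_words [DecidableEq ι] (hL : IsBracketClosed Lp)
    (hX : ∀ i, X i ∈ Lp (par i)) (ev : A →ₗ[ℂ] ℂ)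
    (hiso : ∀ p, ∀ Z ∈ Lp p, ∃ Z₀ ∈ Lp p, (∀ f, ev (Z₀ • f) = 0) ∧
      Z - Z₀ ∈ Submodule.span ℂ (Set.range X)) {l : List ι} (hl : ∀ i, i ∈ l) {f : A}
    (hf : OrdVanish par X (fun g => ev g = 0) l f) (k : ℕ) :
    ∀ T ∈ oneSup Lp ^ k, ev (T • f) = 0 := by
  -- It suffices to treat words in two kinds of letters: those whose values `ev` annihilates (the
  -- isotropy of the origin) and the `X i`.
  let G : Set R := {Z | (∃ p, Z ∈ Lp p) ∧ ∀ f, ev (Z • f) = 0} ∪ Set.range X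
  have hG : ∀ Z ∈ G, ∃ p, Z ∈ Lp p := by
    rintro _ (h | ⟨i, rfl⟩)
    · exact h.1
    · exact ⟨_, hX i⟩
  have hLG : ∀ p, Lp p ≤ Submodule.span ℂ (insert 1 G) := fun p Z hZ => by
    obtain ⟨Z₀, h0, h1, h2⟩ := hiso p Z hZ
    rw [← sub_add_cancel Z Z₀]
    refine add_mem (Submodule.span_mono ?_ h2) (Submodule.subset_span ?_)
    · exact Set.subset_union_right.trans (Set.subset_insert _ _)
    · exact Set.mem_insert_of_mem _ (Or.inl ⟨⟨p, h0⟩, h1⟩)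
  have hM : oneSup Lp ≤ Submodule.span ℂ (insert 1 G) :=
    sup_le (Submodule.one_le.2 (Submodule.subset_span (Set.mem_insert _ _)))
      (sup_le (hLG 0) (hLG 1))
  induction k with
  | zero =>
    intro T hT
    rw [pow_zero] at hT
    obtain ⟨c, rfl⟩ := Submodule.mem_one.1 hT
    rw [algebraMap_smul, map_smul, hf.base, smul_zero]
  | succ k ih =>
    intro T hT
    replace hT := pow_le_pow_left' hM (k + 1) hT
    rw [Submodule.span_pow] at hT
    induction hT using Submodule.span_induction with
    | zero => simp
    | add x y _ _ hx hy => rw [add_smul, map_add, hx, hy, add_zero]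
    | smul c x _ hx => rw [smul_assoc, map_smul ev, hx, smul_zero]
    | mem x hx =>
      obtain ⟨w, hw, hlen, rfl⟩ := exists_list_of_mem_pow hx
      -- An isotropy letter is moved to the far left modulo shorter words; it then acts last, and
      -- `ev` gives zero.
      by_cases h : ∃ Z ∈ w, ∀ f, ev (Z • f) = 0
      · classical
        obtain ⟨Z, hZ, hZ0⟩ := h
        obtain ⟨c, hc⟩ := exists_smul_sub_mem_of_perm hL (List.perm_cons_erase hZ)
          fun a ha => hG a (hw a ha)
        have := ih _ (oneSup_pow_mono (by omega) hc)
        rw [sub_smul, map_sub, smul_assoc, map_smul ev, sub_eq_zero] at this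
        rw [this, List.prod_cons, mul_smul, hZ0, smul_zero]
      · have : w ∈ Set.range (List.map X) := by
          rw [Set.range_list_map]
          intro a ha
          exact (hw a ha).resolve_left fun h' => h ⟨a, ha, h'.2⟩
        obtain ⟨w, rfl⟩ := this
        rw [List.length_map] at hlen
        exact OrdVanish.word_apply hL hX ev l f k hf ih w (fun i _ => hl i) hlen

end FilteredSuper


/-! ### The filtration of `Λ(m,n)` by powers of the augmentation ideal: completeness, constant
terms, density of polynomials. -/

namespace FormalSuper

open Finset FilteredSuper

variable {m n : ℕ}

/-- The filtration of the Grassmann algebra by the degree. -/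
def grassFil (n k : ℕ) : Submodule ℂ (Grassmann n) :=
  ⨆ j : ℕ, ⨆ _ : k ≤ j, (ExteriorAlgebra.ι ℂ (M := Fin n → ℂ)).range ^ j

theorem grassFil_zero : grassFil n 0 = ⊤ := by
  have := CliffordAlgebra.iSup_ι_range_eq_top (0 : QuadraticForm ℂ (Fin n → ℂ))
  rw [eq_top_iff, ← this]
  exact iSup_le fun j => le_iSup₂_of_le j (Nat.zero_le j) le_rfl

theorem grassFil_anti : Antitone (grassFil n) := fun _ _ h =>
  iSup₂_le fun j hj => le_iSup₂_of_le j (h.trans hj) le_rfl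

theorem grassFil_mul_mem {i j : ℕ} {a b : Grassmann n} (ha : a ∈ grassFil n i)
    (hb : b ∈ grassFil n j) : a * b ∈ grassFil n (i + j) := by
  have : grassFil n i * grassFil n j ≤ grassFil n (i + j) := by
    simp only [grassFil, Submodule.iSup_mul, Submodule.mul_iSup]
    refine iSup₂_le fun k hk => iSup₂_le fun l hl => ?_
    rw [← pow_add]
    exact le_iSup₂_of_le _ (by omega) le_rfl
  exact this (Submodule.mul_mem_mul ha hb)

theorem grassFil_eq_bot {k : ℕ} (hk : n < k) : grassFil n k = ⊥ := by
  rw [eq_bot_iff]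
  refine iSup₂_le fun j hj => ?_
  have h := exteriorPower.finrank_eq ℂ j (M := Fin n → ℂ)
  rw [Module.finrank_fin_fun, Nat.choose_eq_zero_of_lt (by omega)] at h
  exact (Submodule.finrank_eq_zero.1 h).le

/-- The powers of the augmentation ideal, as complex subspaces. -/
def fil (m n k : ℕ) : Submodule ℂ (Lam m n) := (augIdeal m n ^ k).restrictScalars ℂ

theorem mem_fil {k : ℕ} {f : Lam m n} : f ∈ fil m n k ↔ f ∈ augIdeal m n ^ k := Iff.rfl

theorem mem_fil_one {f : Lam m n} : f ∈ fil m n 1 ↔ f ∈ augIdeal m n := by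
  rw [mem_fil, Submodule.pow_one]

theorem gen_mem_fil (k : Fin m ⊕ Fin n) : (gen k : Lam m n) ∈ fil m n 1 :=
  mem_fil_one.2 (gen_mem_augIdeal k)

/-- Induction principle for the augmentation ideal: a linear condition need only be checked on the
indeterminates and under multiplication from both sides. -/
theorem mem_augIdeal_of_closed {S : Submodule ℂ (Lam m n)} (hg : ∀ k, gen k ∈ S)
    (hl : ∀ a, ∀ b ∈ S, a * b ∈ S) (hr : ∀ a ∈ S, ∀ b, a * b ∈ S) {f : Lam m n}
    (hf : f ∈ augIdeal m n) : f ∈ S := by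
  let I : TwoSidedIdeal (Lam m n) := TwoSidedIdeal.mk' S S.zero_mem S.add_mem S.neg_mem
    (fun {x y} hy => hl x y hy) (fun {x y} hx => hr x hx y)
  have hI : ∀ f, f ∈ I ↔ f ∈ S := fun f => by simp [I, TwoSidedIdeal.mem_mk']
  have := TwoSidedIdeal.mem_span_iff.1 (TwoSidedIdeal.mem_asIdeal.1 hf) I (by
    rintro _ ⟨k, rfl⟩
    exact (hI _).2 (hg k))
  exact (hI _).1 this

theorem coeff_smul' (c : ℂ) (f : Lam m n) (d : Fin m →₀ ℕ) :
    MvPowerSeries.coeff d (c • f) = c • MvPowerSeries.coeff d f := rfl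

/-- The power series whose coefficients lie in the prescribed steps of the degree filtration. -/
def coeffFil (m n k : ℕ) : Submodule ℂ (Lam m n) where
  carrier := {f | ∀ d : Fin m →₀ ℕ, MvPowerSeries.coeff d f ∈ grassFil n (k - d.degree)}
  add_mem' := fun hf hg d => by rw [map_add]; exact add_mem (hf d) (hg d)
  zero_mem' := fun d => by rw [map_zero]; exact zero_mem _
  smul_mem' := fun c f hf d => by rw [coeff_smul']; exact Submodule.smul_mem _ _ (hf d)

theorem coeffFil_mul_mem {i j : ℕ} {f g : Lam m n} (hf : f ∈ coeffFil m n i)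
    (hg : g ∈ coeffFil m n j) : f * g ∈ coeffFil m n (i + j) := fun d => by
  classical
  rw [MvPowerSeries.coeff_mul]
  refine Submodule.sum_mem _ fun p hp => ?_
  refine grassFil_anti ?_ (grassFil_mul_mem (hf p.1) (hg p.2))
  rw [← mem_antidiagonal.1 hp, map_add]
  omega

theorem mem_coeffFil_zero (f : Lam m n) : f ∈ coeffFil m n 0 := fun d => by
  rw [Nat.zero_sub, grassFil_zero]; trivial

theorem gen_mem_coeffFil (k : Fin m ⊕ Fin n) : gen k ∈ coeffFil m n 1 := by
  classical
  intro d
  rcases k with i | j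
  · simp only [gen, evenVar, Sum.elim_inl, MvPowerSeries.coeff_X]
    split_ifs with h
    · rw [h, Finsupp.degree_single, grassFil_zero]; trivial
    · exact zero_mem _
  · simp only [gen, oddVar, Sum.elim_inr, MvPowerSeries.coeff_C]
    split_ifs with h
    · refine Submodule.mem_iSup_of_mem 1 (Submodule.mem_iSup_of_mem (by omega) ?_)
      rw [pow_one]
      exact ⟨_, rfl⟩
    · exact zero_mem _

theorem fil_le_coeffFil (k : ℕ) : fil m n k ≤ coeffFil m n k := by
  induction k with
  | zero => exact fun f _ => mem_coeffFil_zero f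
  | succ k ih =>
    intro f hf
    rw [mem_fil, Ideal.IsTwoSided.pow_succ] at hf
    refine Submodule.mul_induction_on hf ?_ fun _ _ => add_mem
    intro a ha b hb
    rw [add_comm]
    refine coeffFil_mul_mem (mem_augIdeal_of_closed gen_mem_coeffFil ?_ ?_ ha) (ih hb)
    · intro a b hb
      simpa using coeffFil_mul_mem (mem_coeffFil_zero a) hb
    · intro a ha b
      simpa using coeffFil_mul_mem ha (mem_coeffFil_zero b)

/-- The Grassmann part of a monomial has degree at most `n`, so total degree at least `k` forces
degree at least `k - n` in the even variables. -/
theorem coeff_eq_zero_of_mem_fil {k : ℕ} {f : Lam m n} (hf : f ∈ fil m n k) {d : Fin m →₀ ℕ}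
    (hd : d.degree + n < k) : MvPowerSeries.coeff d f = 0 := by
  have := fil_le_coeffFil k hf d
  rwa [grassFil_eq_bot (by omega), Submodule.mem_bot] at this

theorem coeff_X_mul (i : Fin m) (f : Lam m n) (d : Fin m →₀ ℕ) :
    MvPowerSeries.coeff d (evenVar i * f) =
      if d i = 0 then 0 else MvPowerSeries.coeff (d - Finsupp.single i 1) f := by
  classical
  change MvPowerSeries.coeff d (MvPowerSeries.monomial (Finsupp.single i 1) 1 * f) = _
  rw [MvPowerSeries.coeff_monomial_mul, one_mul]
  by_cases h : d i = 0
  · rw [if_pos h, if_neg (by rw [Finsupp.single_le_iff]; omega)]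
  · rw [if_neg h, if_pos (by rw [Finsupp.single_le_iff]; omega)]

theorem mem_fil_of_coeff_eq_zero {k : ℕ} {f : Lam m n}
    (h : ∀ d : Fin m →₀ ℕ, d.degree < k → MvPowerSeries.coeff d f = 0) : f ∈ fil m n k := by
  induction k generalizing f with
  | zero => rw [mem_fil, Submodule.pow_zero, Ideal.one_eq_top]; trivial
  | succ k ih =>
    -- Euler's identity: the weights become `d i / d.degree` after multiplication by `x_i`, and
    -- these add up to `1`. Hence `f = ∑ x_i g_i`.
    let g : Fin m → Lam m n := fun i e =>
      ((e i + 1 : ℂ) / (e.degree + 1)) • MvPowerSeries.coeff (e + Finsupp.single i 1) f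
    have hg : ∀ i e, MvPowerSeries.coeff e (g i) =
      ((e i + 1 : ℂ) / (e.degree + 1)) • MvPowerSeries.coeff (e + Finsupp.single i 1) f :=
      fun _ _ => rfl
    have e : f = ∑ i, evenVar i * g i := by
      ext d
      rw [map_sum]
      have h1 : ∀ i, MvPowerSeries.coeff d (evenVar i * g i) =
          ((d i : ℂ) / d.degree) • MvPowerSeries.coeff d f := fun i => by
        rw [coeff_X_mul]
        split_ifs with h0
        · rw [h0, Nat.cast_zero, zero_div, zero_smul]
        · have hle : Finsupp.single i 1 ≤ d := by
            rw [Finsupp.single_le_iff]; omega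
          obtain ⟨e, rfl⟩ := le_iff_exists_add'.1 hle
          rw [add_tsub_cancel_right, hg, map_add, Finsupp.degree_single]
          simp
      rw [sum_congr rfl fun i _ => h1 i, ← sum_smul, ← sum_div, ← Nat.cast_sum,
        ← Finsupp.degree_eq_sum]
      by_cases hd : d.degree = 0
      · rw [h d (by omega), smul_zero]
      · rw [div_self (by exact_mod_cast hd), one_smul]
    rw [e]
    refine Submodule.sum_mem _ fun i _ => ?_
    rw [mem_fil, Ideal.IsTwoSided.pow_succ]
    refine Ideal.mul_mem_mul (gen_mem_augIdeal (Sum.inl i)) (ih fun d hd => ?_)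
    rw [hg, h _ (by rw [map_add, Finsupp.degree_single]; omega), smul_zero]

theorem isCompleteFiltration_fil : IsCompleteFiltration (fil m n) where
  zero_eq_top := by
    rw [eq_top_iff]
    intro f _
    rw [mem_fil, Submodule.pow_zero, Ideal.one_eq_top]; trivial
  anti _ _ h := augIdeal_pow_anti h
  mul_mem ha hb := by
    rw [mem_fil, Ideal.IsTwoSided.pow_add]
    exact Ideal.mul_mem_mul ha hb
  eq_zero h := by
    ext d
    rw [coeff_eq_zero_of_mem_fil (h (d.degree + n + 1)) (by omega), map_zero]
  exists_sum s hs := by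
    -- The coefficient of `s k` at `d` vanishes for `k > d.degree + n`, so this cutoff loses
    -- nothing.
    let S : Lam m n := fun d =>
      ∑ k ∈ range (d.degree + n + 1), MvPowerSeries.coeff d (s k)
    have hS : ∀ d, MvPowerSeries.coeff d S =
      ∑ k ∈ range (d.degree + n + 1), MvPowerSeries.coeff d (s k) := fun _ => rfl
    refine ⟨S, fun K => ?_⟩
    -- The coefficients of degree below `K` are determined only by `n` further terms; the extra
    -- terms, from index `K` on, lie in step `K` anyway.
    have h1 : S - ∑ k ∈ range (K + n + 1), s k ∈ fil m n K := by
      refine mem_fil_of_coeff_eq_zero fun d hd => ?_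
      rw [map_sub, map_sum, hS, sub_eq_zero]
      refine sum_subset (range_subset_range.2 (by omega)) fun k _ hk => ?_
      rw [mem_range] at hk
      exact coeff_eq_zero_of_mem_fil (hs k) (by omega)
    have h2 : ∑ k ∈ Ico K (K + n + 1), s k ∈ fil m n K :=
      Submodule.sum_mem _ fun k hk => augIdeal_pow_anti (mem_Ico.1 hk).1 (hs k)
    have := add_mem h1 h2
    rw [← sum_range_add_sum_Ico s (by omega : K ≤ K + n + 1)] at this
    convert this using 1
    abel

theorem constTerm_apply (f : Lam m n) :
    constTerm f = ExteriorAlgebra.algebraMapInv (MvPowerSeries.constantCoeff f) := rfl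

theorem constTerm_mul (f g : Lam m n) : constTerm (f * g) = constTerm f * constTerm g := by
  rw [constTerm_apply, map_mul, map_mul]; rfl

theorem constTerm_algebraMap (c : ℂ) : constTerm (algebraMap ℂ (Lam m n) c) = c := by
  rw [constTerm_apply, MvPowerSeries.algebraMap_apply, MvPowerSeries.constantCoeff_C,
    AlgHom.commutes]; rfl

theorem constTerm_gen (k : Fin m ⊕ Fin n) : constTerm (gen k : Lam m n) = 0 := by
  rcases k with i | j
  · rw [constTerm_apply]
    simp [gen, evenVar]
  · rw [constTerm_apply]
    simp [gen, oddVar, ExteriorAlgebra.algebraMapInv]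

theorem oddVar_sum (v : Fin n → ℂ) :
    (MvPowerSeries.C (ExteriorAlgebra.ι ℂ v) : Lam m n) = ∑ j, v j • oddVar j := by
  have : v = ∑ j, v j • Pi.single j (1 : ℂ) := by
    ext k
    simp [Finset.sum_apply, Pi.single_apply]
  conv_lhs => rw [this]
  rw [map_sum, map_sum]
  refine sum_congr rfl fun j _ => ?_
  rw [map_smul]
  classical
  ext d
  rw [coeff_smul', oddVar, MvPowerSeries.coeff_C, MvPowerSeries.coeff_C]
  split_ifs
  · rfl
  · rw [smul_zero]

theorem C_sub_mem_augIdeal (a : Grassmann n) :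
    (MvPowerSeries.C a - algebraMap ℂ (Lam m n) (ExteriorAlgebra.algebraMapInv a)) ∈
      augIdeal m n := by
  induction a using CliffordAlgebra.left_induction with
  | algebraMap r =>
    rw [MvPowerSeries.algebraMap_apply]
    have : ExteriorAlgebra.algebraMapInv (algebraMap ℂ (Grassmann n) r) = r :=
      AlgHom.commutes _ r
    erw [this]
    rw [sub_self]
    exact zero_mem _
  | add x y hx hy =>
    have := add_mem hx hy
    rw [map_add, map_add, map_add]
    convert this using 1
    abel
  | ι_mul x v hx =>
    have h0 : ExteriorAlgebra.algebraMapInv (ExteriorAlgebra.ι ℂ v * x) = 0 := by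
      rw [map_mul]
      simp [ExteriorAlgebra.algebraMapInv]
    change MvPowerSeries.C (ExteriorAlgebra.ι ℂ v * x) - algebraMap ℂ (Lam m n)
      (ExteriorAlgebra.algebraMapInv (ExteriorAlgebra.ι ℂ v * x)) ∈ _
    rw [h0, map_zero, sub_zero, map_mul, oddVar_sum]
    refine Ideal.mul_mem_right _ _ (Submodule.sum_mem _ fun j _ => ?_)
    exact Submodule.smul_of_tower_mem _ _ (gen_mem_augIdeal (Sum.inr j))

theorem sub_constTerm_mem (f : Lam m n) :
    f - algebraMap ℂ (Lam m n) (constTerm f) ∈ fil m n 1 := by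
  have h1 : f - MvPowerSeries.C (MvPowerSeries.constantCoeff f) ∈ fil m n 1 := by
    refine mem_fil_of_coeff_eq_zero fun d hd => ?_
    have : d = 0 := (Finsupp.degree_eq_zero_iff d).1 (by omega)
    rw [this, map_sub, MvPowerSeries.coeff_zero_C]
    exact sub_self _
  have h2 := mem_fil_one.2 (C_sub_mem_augIdeal (m := m) (MvPowerSeries.constantCoeff f))
  have := add_mem h1 h2
  rwa [sub_add_sub_cancel] at this

theorem mem_fil_one_iff {f : Lam m n} : f ∈ fil m n 1 ↔ constTerm f = 0 := by
  constructor
  · intro hf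
    refine mem_augIdeal_of_closed (S := LinearMap.ker constTerm) (fun k => constTerm_gen k) ?_ ?_
      (mem_fil_one.1 hf)
    · intro a b hb
      rw [LinearMap.mem_ker] at *
      rw [constTerm_mul, hb, mul_zero]
    · intro a ha b
      rw [LinearMap.mem_ker] at *
      rw [constTerm_mul, ha, zero_mul]
  · intro h
    simpa [h] using sub_constTerm_mem f

/-- Polynomials in the indeterminates are dense. Successive approximation reduces this to one step
of the filtration, and products reduce that step to constants and to linear terms. -/
theorem exists_adjoin_sub_mem (k : ℕ) (f : Lam m n) :
    ∃ a ∈ Algebra.adjoin ℂ (Set.range (gen : Fin m ⊕ Fin n → Lam m n)), f - a ∈ fil m n k := by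
  have hF := isCompleteFiltration_fil (m := m) (n := n)
  let B : Subalgebra ℂ (Lam m n) := Algebra.adjoin ℂ (Set.range gen)
  have h1 : ∀ f ∈ fil m n 1, ∃ a ∈ B, a ∈ fil m n 1 ∧ f - a ∈ fil m n 2 := by
    intro f hf
    let S : Submodule ℂ (Lam m n) := (Subalgebra.toSubmodule B ⊓ fil m n 1) ⊔ fil m n 2
    have hS : ∀ f, f ∈ S ↔ ∃ a ∈ B, a ∈ fil m n 1 ∧ f - a ∈ fil m n 2 := fun f => by
      rw [Submodule.mem_sup]
      constructor
      · rintro ⟨a, ⟨ha, ha'⟩, b, hb, rfl⟩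
        exact ⟨a, ha, ha', by rwa [add_sub_cancel_left]⟩
      · rintro ⟨a, ha, ha', h⟩
        exact ⟨a, ⟨ha, ha'⟩, _, h, add_sub_cancel _ _⟩
    have hS1 : S ≤ fil m n 1 := sup_le inf_le_right (hF.anti (by omega))
    refine (hS f).1 (mem_augIdeal_of_closed (S := S) (fun k => ?_) ?_ ?_ (mem_fil_one.1 hf))
    · exact Submodule.mem_sup_left ⟨Algebra.subset_adjoin ⟨k, rfl⟩, gen_mem_fil k⟩
    · intro a b hb
      have := Submodule.add_mem _ (Submodule.mem_sup_right (S := Subalgebra.toSubmodule B ⊓ fil m n 1)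
        (hF.mul_mem (sub_constTerm_mem a) (hS1 hb))) (S.smul_mem (constTerm a) hb)
      rwa [sub_mul, ← Algebra.smul_def, sub_add_cancel] at this
    · intro a ha b
      have := Submodule.add_mem _ (Submodule.mem_sup_right (S := Subalgebra.toSubmodule B ⊓ fil m n 1)
        (hF.mul_mem (hS1 ha) (sub_constTerm_mem b))) (S.smul_mem (constTerm b) ha)
      rwa [mul_sub, ← Algebra.commutes, ← Algebra.smul_def, sub_add_cancel] at this
  have h2 : ∀ k, ∀ f ∈ fil m n k, ∃ a ∈ B, f - a ∈ fil m n (k + 1) := by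
    intro k
    induction k with
    | zero =>
      intro f _
      exact ⟨_, B.algebraMap_mem (constTerm f), sub_constTerm_mem f⟩
    | succ k ih =>
      intro f hf
      rw [mem_fil, Ideal.IsTwoSided.pow_succ] at hf
      refine Submodule.mul_induction_on hf ?_ ?_
      · intro a ha b hb
        obtain ⟨a', ha', ha1, haa⟩ := h1 a (mem_fil_one.2 ha)
        obtain ⟨b', hb', hbb⟩ := ih b hb
        refine ⟨a' * b', B.mul_mem ha' hb', ?_⟩
        have h3 : a' * (b - b') ∈ fil m n (2 + k) := by
          simpa [add_comm, add_left_comm] using hF.mul_mem ha1 hbb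
        have := add_mem (hF.mul_mem haa hb) h3
        rw [show k + 1 + 1 = 2 + k by ring]
        convert this using 1
        noncomm_ring
      · rintro a b ⟨a', ha', haa⟩ ⟨b', hb', hbb⟩
        refine ⟨a' + b', B.add_mem ha' hb', ?_⟩
        rw [add_sub_add_comm]
        exact add_mem haa hbb
  induction k generalizing f with
  | zero => exact ⟨0, B.zero_mem, by rw [hF.zero_eq_top]; trivial⟩
  | succ k ih =>
    obtain ⟨a, ha, hfa⟩ := ih f
    obtain ⟨b, hb, hab⟩ := h2 k _ hfa
    exact ⟨a + b, B.add_mem ha hb, by rwa [← sub_sub]⟩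

theorem parityAut_mem_fil (k : ℕ) : ∀ f ∈ fil m n k, parityAut f ∈ fil m n k := by
  induction k with
  | zero =>
    intro f _
    rw [isCompleteFiltration_fil.zero_eq_top]; trivial
  | succ k ih =>
    intro f hf
    rw [mem_fil, Ideal.IsTwoSided.pow_succ] at hf
    refine Submodule.mul_induction_on hf ?_ ?_
    · intro a ha b hb
      rw [map_mul, mem_fil, Ideal.IsTwoSided.pow_succ]
      exact Ideal.mul_mem_mul (parityAut_mem_augIdeal ha) (ih b hb)
    · intro a b ha hb
      rw [map_add]
      exact add_mem ha hb

theorem parityAut_smul (c : ℂ) (f : Lam m n) : parityAut (c • f) = c • parityAut f := by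
  ext d
  rw [coeff_parityAut, coeff_smul', coeff_smul', coeff_parityAut, map_smul]

theorem eq_zero_of_neg_eq_self {f : Lam m n} (h : -f = f) : f = 0 := by
  have h2 : (2 : ℂ) • f = 0 := by
    rw [two_smul]
    nth_rewrite 1 [← h]
    exact neg_add_cancel f
  rw [← one_smul ℂ f, ← inv_mul_cancel₀ (two_ne_zero (α := ℂ)), mul_smul, h2, smul_zero]

theorem mem_parity_iff {i : ZMod 2} {f : Lam m n} :
    f ∈ parity i ↔ parityAut f = sgn 1 i • f := by
  refine ⟨parityAut_of_mem, fun h => ?_⟩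
  obtain ⟨f₀, h₀, f₁, h₁, rfl⟩ := exists_even_add_odd f
  rw [map_add, parityAut_of_mem h₀, parityAut_of_mem h₁, sgn_zero_right, sgn_one_one, one_smul,
    neg_one_smul] at h
  rcases zmod_two_cases i with rfl | rfl
  · rw [sgn_zero_right, one_smul, add_right_inj] at h
    rw [eq_zero_of_neg_eq_self h, add_zero]; exact h₀
  · rw [sgn_one_one, neg_one_smul, neg_add, add_left_inj] at h
    rw [eq_zero_of_neg_eq_self h.symm, zero_add]; exact h₁

end FormalSuper


/-! ### Derivations and linear forms of `Λ(m,n)` as instances of the abstract notions. -/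

namespace FormalSuper

open Finset FilteredSuper

variable {m n : ℕ}

theorem sgn_one_add (i p : ZMod 2) : sgn 1 (i + p) = sgn 1 p * sgn 1 i := by
  have h11 : (1 : ZMod 2) + 1 = 0 := by decide
  rcases zmod_two_cases i with rfl | rfl <;> rcases zmod_two_cases p with rfl | rfl <;>
    simp [sgn_zero_right, sgn_one_one, h11]

theorem twist_of_mem (p : ZMod 2) {i : ZMod 2} {f : Lam m n} (hf : f ∈ parity i) :
    twist parityAut p f = sgn p i • f := by
  rcases zmod_two_cases p with rfl | rfl
  · simp [sgn_zero_left]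
  · rw [twist_one, parityAut_of_mem hf]

theorem IsSuperDer.isDer {p : ZMod 2} {D : Module.End ℂ (Lam m n)} (h : IsSuperDer p D) :
    IsDer (fil m n) parityAut p D := by
  have hl : ∀ a b, D (a * b) = D a * b + twist parityAut p a * D b := by
    intro a b
    obtain ⟨f₀, h₀, f₁, h₁, rfl⟩ := exists_even_add_odd a
    rw [add_mul, map_add, h.leibniz 0 f₀ h₀, h.leibniz 1 f₁ h₁, map_add, map_add,
      twist_of_mem p h₀, twist_of_mem p h₁, add_mul, add_mul, smul_mul_assoc, smul_mul_assoc]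
    abel
  refine ⟨hl, fun a => ?_, fun k => ?_⟩
  · obtain ⟨f₀, h₀, f₁, h₁, rfl⟩ := exists_even_add_odd a
    rw [map_add, map_add, parityAut_of_mem (h.map_parity _ _ h₀),
      parityAut_of_mem (h.map_parity _ _ h₁), map_add, map_add, parityAut_of_mem h₀,
      parityAut_of_mem h₁, map_smul, map_smul, smul_add, smul_smul, smul_smul, sgn_one_add,
      sgn_one_add]
  · induction k with
    | zero => intro f _; rw [isCompleteFiltration_fil.zero_eq_top]; trivial
    | succ k ih =>
      intro f hf
      rw [mem_fil, Ideal.IsTwoSided.pow_succ] at hf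
      refine Submodule.mul_induction_on hf ?_ ?_
      · intro a ha b hb
        rw [hl]
        refine add_mem (Ideal.mul_mem_left _ _ hb) ?_
        have := isCompleteFiltration_fil.mul_mem
          (twist_mem parityAut_mem_fil p (mem_fil_one.2 ha)) (ih b hb)
        rwa [add_comm] at this
      · intro a b ha hb
        rw [map_add]
        exact add_mem ha hb

theorem grassmann_mul_ι (a : Grassmann n) (v : Fin n → ℂ) :
    a * ExteriorAlgebra.ι ℂ v =
      ExteriorAlgebra.ι ℂ v * CliffordAlgebra.involute (Q := (0 : QuadraticForm ℂ (Fin n → ℂ))) a := by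
  induction a using ExteriorAlgebra.induction with
  | algebraMap r => rw [AlgHom.commutes, Algebra.commutes]
  | ι w =>
    have : CliffordAlgebra.involute (Q := (0 : QuadraticForm ℂ (Fin n → ℂ)))
        (ExteriorAlgebra.ι ℂ w) = -ExteriorAlgebra.ι ℂ w := CliffordAlgebra.involute_ι w
    rw [this, mul_neg, eq_neg_iff_add_eq_zero]
    exact ExteriorAlgebra.ι_add_mul_swap w v
  | mul a b ha hb => rw [mul_assoc, hb, ← mul_assoc, ha, mul_assoc, map_mul]
  | add a b ha hb => rw [add_mul, ha, hb, map_add, mul_add]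

theorem isParam_even (c : Fin m → ℂ) :
    IsParam (fil m n) parityAut 0 (∑ i, c i • evenVar i) where
  mem := Submodule.sum_mem _ fun i _ => Submodule.smul_mem _ _ (gen_mem_fil (Sum.inl i))
  parity_apply := by
    rw [← mem_parity_iff]
    exact Submodule.sum_mem _ fun i _ => Submodule.smul_mem _ _ (gen_mem_parity (Sum.inl i))
  mul_comm a := by
    rw [twist_zero, RingHom.id_apply, mul_sum, sum_mul]
    refine sum_congr rfl fun i _ => ?_
    rw [mul_smul_comm, smul_mul_assoc, evenVar, MvPowerSeries.X_mul]
  sq h := absurd h (by decide)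

theorem isParam_odd (c : Fin n → ℂ) :
    IsParam (fil m n) parityAut 1 (∑ j, c j • oddVar j) where
  mem := Submodule.sum_mem _ fun i _ => Submodule.smul_mem _ _ (gen_mem_fil (Sum.inr i))
  parity_apply := by
    rw [← mem_parity_iff]
    exact Submodule.sum_mem _ fun i _ => Submodule.smul_mem _ _ (gen_mem_parity (Sum.inr i))
  mul_comm a := by
    rw [twist_one, ← oddVar_sum]
    ext d
    rw [MvPowerSeries.coeff_mul_C, MvPowerSeries.coeff_C_mul, coeff_parityAut, grassmann_mul_ι]
  sq _ := by
    rw [← oddVar_sum, ← map_mul, ExteriorAlgebra.ι_sq_zero, map_zero]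

/-- The parity of an indeterminate. -/
def genParity : Fin m ⊕ Fin n → ZMod 2 := Sum.elim (fun _ => 0) (fun _ => 1)

theorem isParam_sum (p : ZMod 2) (c : Fin m ⊕ Fin n → ℂ) (hc : ∀ k, genParity k ≠ p → c k = 0) :
    IsParam (fil m n) parityAut p (∑ k, c k • gen k) := by
  rcases zmod_two_cases p with rfl | rfl
  · have : (∑ k, c k • gen k : Lam m n) = ∑ i, c (Sum.inl i) • evenVar i := by
      rw [Fintype.sum_sum_type]
      refine add_eq_left.2 (sum_eq_zero fun j _ => ?_)
      rw [hc (Sum.inr j) (by simp [genParity]), zero_smul]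
    rw [this]
    exact isParam_even _
  · have : (∑ k, c k • gen k : Lam m n) = ∑ j, c (Sum.inr j) • oddVar j := by
      rw [Fintype.sum_sum_type]
      refine add_eq_right.2 (sum_eq_zero fun i _ => ?_)
      rw [hc (Sum.inl i) (by simp [genParity]), zero_smul]
    rw [this]
    exact isParam_odd _

theorem partialEven_evenVar (i k : Fin m) :
    partialEven i (evenVar k : Lam m n) = if i = k then 1 else 0 := by
  classical
  ext d
  rw [coeff_partialEven, evenVar, MvPowerSeries.coeff_X]
  by_cases hd : d = 0
  · subst hd
    by_cases hik : i = k
    · subst hik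
      simp
    · have : (Finsupp.single i 1 : Fin m →₀ ℕ) ≠ Finsupp.single k 1 := fun h =>
        hik (Finsupp.single_left_injective one_ne_zero h)
      simp [hik, this]
  · have h1 : d + Finsupp.single i 1 ≠ Finsupp.single k 1 := fun h => by
      have h2 := congrArg Finsupp.degree h
      rw [map_add, Finsupp.degree_single, Finsupp.degree_single] at h2
      exact hd ((Finsupp.degree_eq_zero_iff d).1 (by omega))
    rw [if_neg h1, smul_zero]
    split_ifs
    · rw [MvPowerSeries.coeff_one, if_neg hd]
    · rw [map_zero]

theorem partialEven_oddVar (i : Fin m) (j : Fin n) :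
    partialEven i (oddVar j : Lam m n) = 0 := by
  classical
  ext d
  rw [coeff_partialEven, oddVar, MvPowerSeries.coeff_C, if_neg, smul_zero, map_zero]
  intro h
  have h2 := congrArg Finsupp.degree h
  rw [map_add, Finsupp.degree_single, map_zero] at h2
  omega

theorem coeff_partialOdd (j : Fin n) (f : Lam m n) (d : Fin m →₀ ℕ) :
    MvPowerSeries.coeff d (partialOdd j f) =
      CliffordAlgebra.contractLeft (Q := (0 : QuadraticForm ℂ (Fin n → ℂ)))
        (LinearMap.proj j) (MvPowerSeries.coeff d f) := rfl

theorem partialOdd_evenVar (j : Fin n) (i : Fin m) :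
    partialOdd j (evenVar i : Lam m n) = 0 := by
  classical
  ext d
  rw [coeff_partialOdd, evenVar, MvPowerSeries.coeff_X]
  split_ifs
  · rw [CliffordAlgebra.contractLeft_one, map_zero]
  · rw [map_zero, map_zero]

theorem partialOdd_oddVar (j k : Fin n) :
    partialOdd j (oddVar k : Lam m n) = if j = k then 1 else 0 := by
  classical
  ext d
  rw [coeff_partialOdd, oddVar, MvPowerSeries.coeff_C]
  split_ifs with hd hjk hjk
  · subst hjk
    rw [MvPowerSeries.coeff_one, if_pos hd]
    exact (CliffordAlgebra.contractLeft_ι _ _ _).trans (by simp)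
  · rw [map_zero]
    exact (CliffordAlgebra.contractLeft_ι _ _ _).trans (by simp [hjk])
  · rw [MvPowerSeries.coeff_one, if_neg hd, map_zero]
  · rw [map_zero, map_zero]

theorem partialGen_gen (k l : Fin m ⊕ Fin n) :
    (partialGen k : W m n).1 (gen l) = if k = l then 1 else 0 := by
  rcases k with i | j <;> rcases l with i' | j'
  · simpa [partialGen, gen] using partialEven_evenVar i i'
  · simpa [partialGen, gen] using partialEven_oddVar i j'
  · simpa [partialGen, gen] using partialOdd_evenVar j i'
  · simpa [partialGen, gen] using partialOdd_oddVar j j'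

theorem partialGen_mem (k : Fin m ⊕ Fin n) :
    (partialGen k : W m n).1 ∈ superDer m n (genParity k) := by
  rcases k with i | j
  · exact partialEven_mem i
  · exact partialOdd_mem j

/-- The derivation with constant coefficients `c`. -/
def constDer (c : Fin m ⊕ Fin n → ℂ) : W m n := ∑ k, c k • partialGen k

theorem constDer_apply (c : Fin m ⊕ Fin n → ℂ) (f : Lam m n) :
    (constDer c).1 f = ∑ k, c k • (partialGen k : W m n).1 f := by
  simp [constDer, LinearMap.sum_apply]

theorem constDer_gen (c : Fin m ⊕ Fin n → ℂ) (l : Fin m ⊕ Fin n) :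
    (constDer c).1 (gen l : Lam m n) = algebraMap ℂ (Lam m n) (c l) := by
  rw [constDer_apply, sum_eq_single l]
  · rw [partialGen_gen, if_pos rfl, Algebra.algebraMap_eq_smul_one]
  · intro k _ hk
    rw [partialGen_gen, if_neg hk, smul_zero]
  · exact fun h => absurd (mem_univ l) h

theorem constDer_mem {p : ZMod 2} {c : Fin m ⊕ Fin n → ℂ} (hc : ∀ k, genParity k ≠ p → c k = 0) :
    (constDer c : W m n).1 ∈ superDer m n p := by
  rw [constDer, AddSubmonoidClass.coe_finsetSum]
  refine Submodule.sum_mem _ fun k _ => ?_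
  by_cases h : genParity k = p
  · exact Submodule.smul_mem _ _ (h ▸ partialGen_mem k)
  · rw [hc k h, zero_smul]
    exact zero_mem _

/-- The constant terms of the coefficients of a derivation. -/
def coeffs : W m n →ₗ[ℂ] (Fin m ⊕ Fin n → ℂ) where
  toFun X k := constTerm (X.1 (gen k))
  map_add' X Y := by ext k; exact map_add constTerm _ _
  map_smul' c X := by ext k; exact map_smul constTerm _ _

theorem projNegOne_eq (X : W m n) : projNegOne X = constDer (coeffs X) := rfl

theorem constTerm_of_mem_odd {f : Lam m n} (hf : f ∈ parity (m := m) (n := n) 1) :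
    constTerm f = 0 := by
  rw [constTerm_apply]
  have h1 := hf 0
  rw [MvPowerSeries.coeff_zero_eq_constantCoeff_apply] at h1
  revert h1
  generalize MvPowerSeries.constantCoeff f = a
  intro h1
  induction a, h1 using CliffordAlgebra.odd_induction with
  | ι v =>
    change ExteriorAlgebra.algebraMapInv (ExteriorAlgebra.ι ℂ v) = 0
    simp [ExteriorAlgebra.algebraMapInv]
  | add x y _ _ ihx ihy => rw [map_add, ihx, ihy, add_zero]
  | ι_mul_ι_mul v w x _ ih =>
    change ExteriorAlgebra.algebraMapInv (_ * x) = 0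
    rw [map_mul, ih, mul_zero]

/-- A derivation of parity `p` maps an indeterminate of the other parity to an odd element, which
has no constant term. -/
theorem coeffs_eq_zero {p : ZMod 2} {X : W m n} (hX : X.1 ∈ superDer m n p)
    {k : Fin m ⊕ Fin n} (hk : genParity k ≠ p) : coeffs X k = 0 := by
  have h1 := hX.map_parity _ _ (gen_mem_parity k)
  refine constTerm_of_mem_odd ?_
  have h2 : (Sum.elim (fun _ => 0) (fun _ => 1) k : ZMod 2) + p = 1 := by
    change genParity k + p = 1
    revert hk
    generalize genParity k = q
    clear h1 hX
    revert p q
    decide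
  rwa [h2] at h1

end FormalSuper


/-! ### Generators of ideals, words and the filtration, dual families, units. -/

namespace FilteredSuper

open Finset

/-- The right ideal generated by the `y k` is already two-sided, because a left factor passes each
`y k` at the cost of a twist. -/
theorem isGeneratedBy_span {A : Type*} [Ring A] {σ : A →+* A} {κ : Type*} [Fintype κ]
    {q : κ → ZMod 2} {y : κ → A} (hy : ∀ k a, a * y k = y k * twist σ (q k) a) {S : Set A}
    (hyS : ∀ k, y k ∈ S) (hS : ∀ u ∈ S, ∃ h : κ → A, u = ∑ k, y k * h k) :
    IsGeneratedBy σ (TwoSidedIdeal.span S) q y := by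
  refine ⟨hy, fun a => ⟨fun ha => ?_, ?_⟩⟩
  · let R : TwoSidedIdeal A := TwoSidedIdeal.mk' {a | ∃ h : κ → A, a = ∑ k, y k * h k}
      ⟨0, by simp⟩
      (by
        rintro _ _ ⟨h, rfl⟩ ⟨h', rfl⟩
        exact ⟨h + h', by simp [mul_add, sum_add_distrib]⟩)
      (by
        rintro _ ⟨h, rfl⟩
        exact ⟨-h, by simp⟩)
      (by
        rintro x _ ⟨h, rfl⟩
        refine ⟨fun k => twist σ (q k) x * h k, ?_⟩
        rw [mul_sum]
        refine sum_congr rfl fun k _ => ?_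
        rw [← mul_assoc, hy, mul_assoc])
      (by
        rintro _ x ⟨h, rfl⟩
        refine ⟨fun k => h k * x, ?_⟩
        rw [sum_mul]
        exact sum_congr rfl fun k _ => mul_assoc _ _ _)
    have := TwoSidedIdeal.mem_span_iff.1 ha R (fun u hu => by
      rw [SetLike.mem_coe, TwoSidedIdeal.mem_mk']
      exact hS u hu)
    rwa [TwoSidedIdeal.mem_mk'] at this
  · rintro ⟨h, rfl⟩
    exact sum_mem fun k _ => TwoSidedIdeal.mul_mem_right _ _ _ (TwoSidedIdeal.subset_span (hyS k))

theorem oneSup_pow_lowers {R : Type*} [Ring R] [Algebra ℂ R] {Lp : ZMod 2 → Submodule ℂ R}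
    {A : Type*} [AddCommGroup A] [Module ℂ A] [Module R A] [IsScalarTower ℂ R A]
    {F : ℕ → Submodule ℂ A} (hF : Antitone F)
    (h : ∀ p, ∀ X ∈ Lp p, ∀ k, ∀ a ∈ F (k + 1), X • a ∈ F k) (j : ℕ) :
    ∀ T ∈ oneSup Lp ^ j, ∀ k, ∀ a ∈ F (k + j), T • a ∈ F k := by
  induction j with
  | zero =>
    intro T hT k a ha
    rw [pow_zero] at hT
    obtain ⟨c, rfl⟩ := Submodule.mem_one.1 hT
    rw [algebraMap_smul]
    exact Submodule.smul_mem _ _ ha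
  | succ j ih =>
    intro T hT k a ha
    rw [pow_succ'] at hT
    refine Submodule.mul_induction_on hT ?_ fun x y hx hy => ?_
    · intro X hX T hT
      rw [mul_smul]
      have h1 := ih T hT (k + 1) a (by rwa [add_assoc, add_comm 1 j])
      obtain ⟨c, hc, Y, hY, rfl⟩ := Submodule.mem_sup.1 hX
      obtain ⟨Y₀, h₀, Y₁, h₁, rfl⟩ := Submodule.mem_sup.1 hY
      obtain ⟨c, rfl⟩ := Submodule.mem_one.1 hc
      rw [add_smul, add_smul, algebraMap_smul]
      exact add_mem (Submodule.smul_mem _ _ (hF (Nat.le_succ k) h1))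
        (add_mem (h 0 _ h₀ _ _ h1) (h 1 _ h₁ _ _ h1))
    · rw [add_smul]
      exact add_mem hx hy

theorem mul_mem_oneSup_pow {R : Type*} [Ring R] [Algebra ℂ R] {Lp : ZMod 2 → Submodule ℂ R}
    {k : ℕ} {T X : R} (hT : T ∈ oneSup Lp ^ k) (hX : X ∈ oneSup Lp) :
    T * X ∈ oneSup Lp ^ (k + 1) := by
  rw [pow_succ]
  exact Submodule.mul_mem_mul hT hX

/-- A subspace of `ℂ^κ` has a basis with a dual family of linear forms on `ℂ^κ`. -/
theorem exists_dual_family {κ : Type*} [Fintype κ] (V : Submodule ℂ (κ → ℂ)) :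
    ∃ (r : ℕ) (b τ : Fin r → κ → ℂ), (∀ i, b i ∈ V) ∧
      (∀ i j, ∑ k, τ i k * b j k = if i = j then 1 else 0) ∧
      ∀ w ∈ V, ∑ i, (∑ k, τ i k * w k) • b i = w := by
  classical
  let B := Module.finBasis ℂ V
  choose g hg using fun i => LinearMap.exists_extend (B.coord i)
  have hgs : ∀ i w, g i w = ∑ k, g i (Pi.single k 1) * w k := fun i w => by
    conv_lhs => rw [← LinearMap.sum_single_apply (φ := fun _ : κ => ℂ) w, map_sum]
    refine sum_congr rfl fun k _ => ?_
    rw [mul_comm, ← smul_eq_mul, ← map_smul]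
    congr 1
    ext l
    simp [Pi.single_apply]
  have hgB : ∀ i (w : V), g i w = B.coord i w := fun i w => DFunLike.congr_fun (hg i) w
  refine ⟨_, fun i => B i, fun i k => g i (Pi.single k 1), fun i => (B i).2, fun i j => ?_,
    fun w hw => ?_⟩
  · rw [← hgs, hgB, Module.Basis.coord_apply, Module.Basis.repr_self, Finsupp.single_apply]
    simp only [eq_comm]
  · simp only [← hgs]
    have := congrArg Subtype.val (B.sum_repr ⟨w, hw⟩)
    rw [AddSubmonoidClass.coe_finsetSum] at this
    refine Eq.trans (sum_congr rfl fun i _ => ?_) this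
    exact congrArg (· • (B i : κ → ℂ)) (hgB i ⟨w, hw⟩)

/-- The geometric series in `g` inverts `1 - g`. -/
theorem one_mem_of_unit {A : Type*} [Ring A] [Algebra ℂ A] {F : ℕ → Submodule ℂ A}
    (hF : IsCompleteFiltration F) {I : TwoSidedIdeal A} {g : A} (hg : g ∈ F 1)
    (hI : 1 - g ∈ I) : (1 : A) ∈ I := by
  obtain ⟨S, hS⟩ := hF.exists_sum (fun k => g ^ k) (hF.pow_mem hg)
  have : (1 - g) * S = 1 := hF.eq_of_sub_mem fun K => by
    have h1 := hF.mul_mem_left (1 - g) (hS K)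
    rw [mul_sub, mul_neg_geom_sum] at h1
    have := sub_mem h1 (hF.pow_mem hg K)
    convert this using 1
    abel
  rw [← this]
  exact TwoSidedIdeal.mul_mem_right _ _ _ hI

end FilteredSuper

/-! ### Unipotent automorphisms of `Λ(m,n)`, and `V` and `V*` in coordinates. -/

namespace FormalSuper

open Finset FilteredSuper

variable {m n : ℕ}

/-- The identity `Φ(ab) - ab = (Φ(a) - a) Φ(b) + a (Φ(b) - b)` carries the estimate from the
indeterminates to the maximal ideal, and then to its powers. -/
theorem unipotent_of_gen {Φ : Lam m n →ₐ[ℂ] Lam m n} (hΦ : ∀ k, ∀ a ∈ fil m n k, Φ a ∈ fil m n k)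
    (h : ∀ k, Φ (gen k) - gen k ∈ fil m n 2) (k : ℕ) :
    ∀ a ∈ fil m n k, Φ a - a ∈ fil m n (k + 1) := by
  have hF := isCompleteFiltration_fil (m := m) (n := n)
  have hmul : ∀ a b, Φ (a * b) - a * b = (Φ a - a) * Φ b + a * (Φ b - b) := fun a b => by
    rw [map_mul]; noncomm_ring
  have h0 : ∀ a, Φ a - a ∈ fil m n 1 := fun a => by
    have h1 := sub_constTerm_mem a
    have := sub_mem (hΦ 1 _ h1) h1
    rwa [map_sub, AlgHom.commutes, sub_sub_sub_cancel_right] at this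
  have h1 : ∀ a ∈ fil m n 1, Φ a - a ∈ fil m n 2 := by
    intro a ha
    let S : Submodule ℂ (Lam m n) :=
      fil m n 1 ⊓ (fil m n 2).comap (Φ.toLinearMap - LinearMap.id)
    have hS : ∀ a, a ∈ S ↔ a ∈ fil m n 1 ∧ Φ a - a ∈ fil m n 2 := fun a => Iff.rfl
    refine ((hS a).1 (mem_augIdeal_of_closed (S := S) (fun k => ⟨gen_mem_fil k, h k⟩) ?_ ?_
      (mem_fil_one.1 ha))).2
    · intro a b hb
      refine ⟨hF.mul_mem_left _ hb.1, ?_⟩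
      change Φ (a * b) - a * b ∈ fil m n 2
      rw [hmul]
      exact add_mem (hF.mul_mem (h0 a) (hΦ 1 _ hb.1)) (hF.mul_mem_left _ hb.2)
    · intro a ha b
      refine ⟨hF.mul_mem_right _ ha.1, ?_⟩
      change Φ (a * b) - a * b ∈ fil m n 2
      rw [hmul]
      exact add_mem (hF.mul_mem_right _ ha.2) (hF.mul_mem ha.1 (h0 b))
  induction k with
  | zero => exact fun a _ => h0 a
  | succ k ih =>
    intro f hf
    rw [mem_fil, Ideal.IsTwoSided.pow_succ] at hf
    refine Submodule.mul_induction_on hf ?_ ?_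
    · intro a ha b hb
      have ha := mem_fil_one.2 ha
      rw [hmul]
      refine add_mem ?_ ?_
      · have := hF.mul_mem (h1 a ha) (hΦ k b hb)
        rwa [show 2 + k = k + 1 + 1 by ring] at this
      · have := hF.mul_mem ha (ih b hb)
        rwa [show 1 + (k + 1) = k + 1 + 1 by ring] at this
    · intro a b ha hb
      rw [map_add, add_sub_add_comm]
      exact add_mem ha hb

theorem continuous_of_map_fil {f : Lam m n → Lam m n}
    (h : ∀ k a b, a - b ∈ fil m n k → f a - f b ∈ fil m n k) : Continuous f := by
  rw [continuous_def]
  intro U hU a ha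
  obtain ⟨k, hk⟩ := hU (f a) ha
  exact ⟨k, fun g hg => hk _ (h k g a hg)⟩

/-- The continuous automorphism given by a unipotent endomorphism. -/
theorem exists_contAut {Φ : Lam m n →ₐ[ℂ] Lam m n} (hΦ : IsGradedLocal (fil m n) parityAut Φ)
    (h : ∀ k, Φ (gen k) - gen k ∈ fil m n 2) :
    ∃ φ : ContAut m n, ∀ f, φ.toAlgEquiv f = Φ f := by
  have hu := unipotent_of_gen hΦ.map_mem h
  have hb := bijective_of_unipotent isCompleteFiltration_fil Φ.toLinearMap hu
  let e := AlgEquiv.ofBijective Φ hb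
  have he : ∀ f, e f = Φ f := fun _ => rfl
  refine ⟨⟨e, fun i f => ?_, ?_, ?_⟩, he⟩
  · rw [mem_parity_iff, mem_parity_iff, he, ← hΦ.comm, ← map_smul]
    exact hb.1.eq_iff
  · refine continuous_of_map_fil fun k a b hab => ?_
    rw [← map_sub]
    exact hΦ.map_mem k _ hab
  · refine continuous_of_map_fil fun k a b hab => ?_
    rw [← map_sub]
    refine mem_of_apply_mem_of_unipotent isCompleteFiltration_fil Φ.toLinearMap hu ?_
    have : Φ (e.symm (a - b)) = a - b := e.apply_symm_apply _
    change Φ (e.symm (a - b)) ∈ _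
    rwa [this]

/-- A derivation vanishing at the origin preserves the maximal ideal, and it kills the constants.
These are the isotropy letters of the reordering argument. -/
theorem apply_mem_fil_of_coeffs {p : ZMod 2} {X : W m n} (hX : X.1 ∈ superDer m n p)
    (h : coeffs X = 0) (f : Lam m n) : X.1 f ∈ fil m n 1 := by
  have hF := isCompleteFiltration_fil (m := m) (n := n)
  have hD := IsSuperDer.isDer hX
  have h1 : ∀ f ∈ fil m n 1, X.1 f ∈ fil m n 1 := by
    intro f hf
    let S : Submodule ℂ (Lam m n) := fil m n 1 ⊓ (fil m n 1).comap X.1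
    refine (mem_augIdeal_of_closed (S := S) (fun k => ⟨gen_mem_fil k, ?_⟩) ?_ ?_
      (mem_fil_one.1 hf)).2
    · exact mem_fil_one_iff.2 (congrFun h k)
    · intro a b hb
      refine ⟨hF.mul_mem_left _ hb.1, ?_⟩
      change X.1 (a * b) ∈ fil m n 1
      rw [hD.leibniz]
      exact add_mem (hF.mul_mem_left _ hb.1) (hF.mul_mem_left _ hb.2)
    · intro a ha b
      refine ⟨hF.mul_mem_right _ ha.1, ?_⟩
      change X.1 (a * b) ∈ fil m n 1
      rw [hD.leibniz]
      exact add_mem (hF.mul_mem_right _ ha.2)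
        (hF.mul_mem_right _ (twist_mem parityAut_mem_fil p ha.1))
  have := h1 _ (sub_constTerm_mem f)
  rwa [map_sub, hD.map_algebraMap, sub_zero] at this

theorem constDer_sum_smul_gen (c w : Fin m ⊕ Fin n → ℂ) :
    (constDer w).1 (∑ k, c k • gen k : Lam m n) = algebraMap ℂ (Lam m n) (∑ k, c k * w k) := by
  rw [map_sum, map_sum]
  refine sum_congr rfl fun k _ => ?_
  rw [map_smul, constDer_gen, Algebra.smul_def, map_mul]

theorem exists_eq_sum_smul_gen {u : Lam m n}
    (hu : u ∈ Submodule.span ℂ (Set.range (gen : Fin m ⊕ Fin n → Lam m n))) :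
    ∃ c : Fin m ⊕ Fin n → ℂ, u = ∑ k, c k • gen k := by
  obtain ⟨c, hc⟩ := (Submodule.mem_span_range_iff_exists_fun ℂ).1 hu
  exact ⟨c, hc.symm⟩

theorem algebraMap_lam_eq_zero {c : ℂ} (h : algebraMap ℂ (Lam m n) c = 0) : c = 0 := by
  rw [← constTerm_algebraMap (m := m) (n := n) c, h, map_zero]

theorem sum_smul_gen_mem_dualSubspace {L : Submodule ℂ (W m n)} (c : Fin m ⊕ Fin n → ℂ) :
    (∑ k, c k • gen k : Lam m n) ∈ dualSubspace (L.map projNegOne) ↔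
      ∀ X ∈ L, ∑ k, c k * coeffs X k = 0 := by
  constructor
  · intro h X hX
    have := h.2 _ ⟨X, hX, rfl⟩
    rw [projNegOne_eq, constDer_sum_smul_gen] at this
    exact algebraMap_lam_eq_zero this
  · intro h
    refine ⟨Submodule.sum_mem _ fun k _ => Submodule.smul_mem _ _
      (Submodule.subset_span ⟨k, rfl⟩), ?_⟩
    rintro _ ⟨X, hX, rfl⟩
    rw [projNegOne_eq, constDer_sum_smul_gen, h X hX, map_zero]

/-- The operators of parity `p` in `L`. -/
def homPart (L : Submodule ℂ (W m n)) (p : ZMod 2) : Submodule ℂ (Module.End ℂ (Lam m n)) :=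
  L.map (Submodule.subtype _) ⊓ superDer m n p

theorem mem_homPart {L : Submodule ℂ (W m n)} {p : ZMod 2} {X : W m n} (hX : X ∈ L)
    (h : X.1 ∈ superDer m n p) : X.1 ∈ homPart L p := ⟨⟨X, hX, rfl⟩, h⟩

theorem isBracketClosed_homPart {L : Submodule ℂ (W m n)} (hL : IsSubalgebra L) :
    IsBracketClosed (homPart L) := by
  rintro p q _ ⟨⟨X, hX, rfl⟩, hXp⟩ _ ⟨⟨Y, hY, rfl⟩, hYq⟩
  exact ⟨⟨_, hL.bracket_mem p q X hX Y hY hXp hYq, rfl⟩, superBracket_mem hXp hYq⟩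

end FormalSuper


/-! ### Homogeneous frames, the straightening automorphism and transitivity. -/

namespace FormalSuper

open Finset FilteredSuper

variable {m n : ℕ}

theorem stdIdeal_le_fil {L : Submodule ℂ (W m n)} {f : Lam m n}
    (hf : f ∈ stdIdeal (dualSubspace L)) : f ∈ fil m n 1 := by
  refine mem_fil_one.2 (TwoSidedIdeal.mem_asIdeal.2 ?_)
  refine (TwoSidedIdeal.span_le (I := TwoSidedIdeal.span (Set.range gen))).2 ?_ hf
  intro u hu
  obtain ⟨c, rfl⟩ := exists_eq_sum_smul_gen hu.1
  exact sum_mem fun k _ => smul_mem_twoSidedIdeal _ (TwoSidedIdeal.subset_span ⟨k, rfl⟩)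

/-- A homogeneous frame of a graded subalgebra `L`: elements `X i` of `L` whose projections on
`W(m,n)_{-1}` form a basis, together with a dual family of linear forms. -/
structure HomFrame (L : Submodule ℂ (W m n)) (ι : Type*) [Fintype ι] [DecidableEq ι] where
  par : ι → ZMod 2
  X : ι → W m n
  mem : ∀ i, X i ∈ L
  hom : ∀ i, (X i).1 ∈ superDer m n (par i)
  τ : ι → Fin m ⊕ Fin n → ℂ
  τ_eq_zero : ∀ i k, genParity k ≠ par i → τ i k = 0
  dual : ∀ i j, ∑ k, τ i k * coeffs (X j) k = if i = j then 1 else 0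
  expand : ∀ Z ∈ L, ∑ i, (∑ k, τ i k * coeffs Z k) • coeffs (X i) = coeffs Z

/-- Since `L` is graded, `V` is the sum of its even and odd parts. A dual family is chosen for each
part; pairings across parities vanish because coefficients and forms are supported on indeterminates
of opposite parities. -/
theorem exists_homFrame {L : Submodule ℂ (W m n)} (hL : IsSubalgebra L) :
    ∃ r : ZMod 2 → ℕ, Nonempty (HomFrame L ((p : ZMod 2) × Fin (r p))) := by
  classical
  have hV : ∀ p : ZMod 2, ∃ (r : ℕ) (X : Fin r → W m n) (τ : Fin r → Fin m ⊕ Fin n → ℂ),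
      (∀ i, X i ∈ L ∧ (X i).1 ∈ superDer m n p) ∧ (∀ i k, genParity k ≠ p → τ i k = 0) ∧
      (∀ i j, ∑ k, τ i k * coeffs (X j) k = if i = j then 1 else 0) ∧
      ∀ Z ∈ L, Z.1 ∈ superDer m n p →
        ∑ i, (∑ k, τ i k * coeffs Z k) • coeffs (X i) = coeffs Z := by
    intro p
    obtain ⟨r, b, τ, hb, hτ, he⟩ := exists_dual_family
      ((L ⊓ (superDer m n p).comap (Submodule.subtype _)).map coeffs)
    choose X hX hXb using hb
    have key : ∀ (i : Fin r) (Z : W m n), Z.1 ∈ superDer m n p →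
        ∑ k, (if genParity k = p then τ i k else 0) * coeffs Z k = ∑ k, τ i k * coeffs Z k := by
      intro i Z hZ
      refine sum_congr rfl fun k _ => ?_
      split_ifs with h
      · rfl
      · rw [coeffs_eq_zero hZ h, mul_zero, mul_zero]
    -- Discarding the components of the wrong parity makes the forms homogeneous and does not change
    -- their values on the coefficients of derivations of parity `p`.
    refine ⟨r, X, fun i k => if genParity k = p then τ i k else 0, fun i => hX i,
      fun i k hk => if_neg hk, fun i j => ?_, fun Z hZ hZp => ?_⟩
    · rw [key i _ (hX j).2, hXb, hτ]
    · simp only [key _ _ hZp, hXb]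
      exact he _ ⟨Z, ⟨hZ, hZp⟩, rfl⟩
  choose r X τ hX hτ hd he using hV
  have hcross : ∀ (p q : ZMod 2), p ≠ q → ∀ (i : Fin (r p)) (Z : W m n),
      Z.1 ∈ superDer m n q → ∑ k, τ p i k * coeffs Z k = 0 := by
    intro p q hpq i Z hZ
    refine sum_eq_zero fun k _ => ?_
    by_cases h : genParity k = p
    · rw [coeffs_eq_zero hZ (by rwa [h]), mul_zero]
    · rw [hτ p i k h, zero_mul]
  refine ⟨r, ⟨⟨fun i => i.1, fun i => X i.1 i.2, fun i => (hX _ _).1, fun i => (hX _ _).2,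
    fun i => τ i.1 i.2, fun i => hτ _ _, ?_, ?_⟩⟩⟩
  · rintro ⟨p, i⟩ ⟨q, j⟩
    by_cases h : p = q
    · subst h
      rw [hd]
      simp
    · rw [hcross p q h i _ (hX q j).2, if_neg fun h' => h (congrArg Sigma.fst h')]
  · have hhom : ∀ q, ∀ Z ∈ L, Z.1 ∈ superDer m n q →
        ∑ i : (p : ZMod 2) × Fin (r p), (∑ k, τ i.1 i.2 k * coeffs Z k) • coeffs (X i.1 i.2) =
          coeffs Z := by
      intro q Z hZ hZq
      rw [Fintype.sum_sigma, sum_eq_single q]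
      · exact he q Z hZ hZq
      · intro p _ hp
        exact sum_eq_zero fun i _ => by rw [hcross p q hp i Z hZq, zero_smul]
      · exact fun h => absurd (mem_univ q) h
    intro Z hZ
    obtain ⟨Z₀, h₀, Z₁, h₁, h₀', h₁', rfl⟩ := hL.graded Z hZ
    rw [map_add]
    conv_rhs => rw [← hhom 0 Z₀ h₀ h₀', ← hhom 1 Z₁ h₁ h₁']
    rw [← sum_add_distrib]
    refine sum_congr rfl fun i _ => ?_
    rw [← add_smul, ← sum_add_distrib]
    congr 1
    exact sum_congr rfl fun k _ => mul_add _ _ _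

namespace HomFrame

variable {L : Submodule ℂ (W m n)} {ι : Type*} [Fintype ι] [DecidableEq ι] (B : HomFrame L ι)

/-- The linear form `t i`. -/
def t (i : ι) : Lam m n := ∑ k, B.τ i k • gen k

/-- The projection of `X i`. -/
def v (i : ι) : W m n := constDer (coeffs (B.X i))

theorem v_mem (i : ι) : (B.v i).1 ∈ superDer m n (B.par i) :=
  constDer_mem fun _ hk => coeffs_eq_zero (B.hom i) hk

theorem v_t (i j : ι) : (B.v i).1 (B.t j) = if i = j then 1 else 0 := by
  rw [t, v, constDer_sum_smul_gen, B.dual]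
  simp only [eq_comm (a := j)]
  split_ifs
  · exact map_one _
  · exact map_zero _

/-- The underlying frame of the filtered algebra `Λ(m,n)`. -/
def toFrame : Frame (fil m n) parityAut ι where
  par := B.par
  t := B.t
  v i := (B.v i).1
  X i := (B.X i).1
  param i := isParam_sum _ _ (B.τ_eq_zero i)
  der_v i := IsSuperDer.isDer (B.v_mem i)
  der_X i := IsSuperDer.isDer (B.hom i)
  v_t := B.v_t

/-- The linear forms `gen k - ∑ i, v_i (gen k) t i` generating `V*`. -/
def coord (k : Fin m ⊕ Fin n) : Lam m n := gen k - ∑ i, coeffs (B.X i) k • B.t i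

theorem coord_eq (k : Fin m ⊕ Fin n) :
    B.coord k = ∑ l, ((if l = k then 1 else 0) - ∑ i, coeffs (B.X i) k * B.τ i l) • gen l := by
  simp only [coord, t, sub_smul, sum_sub_distrib, sum_smul, ite_smul, one_smul, zero_smul,
    sum_ite_eq', mem_univ, if_true, smul_sum, smul_smul]
  rw [sum_comm]

theorem isParam_coord (k : Fin m ⊕ Fin n) :
    IsParam (fil m n) parityAut (genParity k) (B.coord k) := by
  rw [coord_eq]
  refine isParam_sum _ _ fun l hl => ?_
  rw [if_neg fun h => hl (congrArg genParity h), zero_sub, neg_eq_zero]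
  refine sum_eq_zero fun i _ => ?_
  by_cases h : genParity k = B.par i
  · rw [B.τ_eq_zero i l (by rwa [← h]), mul_zero]
  · rw [coeffs_eq_zero (B.hom i) h, zero_mul]

theorem coord_mem (k : Fin m ⊕ Fin n) : B.coord k ∈ dualSubspace (L.map projNegOne) := by
  rw [coord_eq, sum_smul_gen_mem_dualSubspace]
  intro Z hZ
  have := congrFun (B.expand Z hZ) k
  simp only [Finset.sum_apply, Pi.smul_apply, smul_eq_mul] at this
  simp only [sub_mul, sum_sub_distrib, ite_mul, one_mul, zero_mul, sum_ite_eq', mem_univ,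
    if_true, sum_mul]
  rw [sum_comm, sub_eq_zero, ← this]
  refine sum_congr rfl fun i _ => ?_
  rw [sum_mul]
  exact sum_congr rfl fun l _ => by ring

/-- For `u = ∑ c_k gen k` in `V*`, the combination `∑ c_k coord k` is `u` itself: the coefficient of
`t i` in the correction is the value of `v i` on `u`, which is zero. -/
theorem isGeneratedBy : IsGeneratedBy parityAut (stdIdeal (dualSubspace (L.map projNegOne)))
    genParity B.coord := by
  refine isGeneratedBy_span (fun k => (B.isParam_coord k).mul_comm) B.coord_mem fun u hu => ?_
  obtain ⟨c, rfl⟩ := exists_eq_sum_smul_gen hu.1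
  refine ⟨fun k => algebraMap ℂ _ (c k), ?_⟩
  have h := (sum_smul_gen_mem_dualSubspace c).1 hu
  have e : ∀ k, B.coord k * algebraMap ℂ _ (c k) =
      c k • gen k - ∑ i, (c k * coeffs (B.X i) k) • B.t i := fun k => by
    rw [← Algebra.commutes, ← Algebra.smul_def, coord, smul_sub, smul_sum]
    simp only [smul_smul]
  rw [sum_congr rfl fun k _ => e k, sum_sub_distrib, sum_comm]
  simp only [← sum_smul, h _ (B.mem _), zero_smul, sum_const_zero, sub_zero]

theorem v_coord (i : ι) (k : Fin m ⊕ Fin n) : (B.v i).1 (B.coord k) = 0 :=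
  (B.coord_mem k).2 _ ⟨B.X i, B.mem i, rfl⟩

/-- The derivation `v i` kills the generators of the ideal, so the Leibniz rule only differentiates
their cofactors. -/
theorem v_mem_stdIdeal (i : ι) : ∀ a ∈ stdIdeal (dualSubspace (L.map projNegOne)),
    (B.v i).1 a ∈ stdIdeal (dualSubspace (L.map projNegOne)) := by
  intro a ha
  obtain ⟨h, rfl⟩ := (B.isGeneratedBy.mem_iff a).1 ha
  rw [map_sum]
  refine sum_mem fun k _ => ?_
  have hk := TwoSidedIdeal.subset_span (B.coord_mem k)
  rw [(IsSuperDer.isDer (B.v_mem i)).leibniz, v_coord, zero_mul, zero_add,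
    twist_of_mem _ (mem_parity_iff.2 (B.isParam_coord k).parity_apply)]
  exact TwoSidedIdeal.mul_mem_right _ _ _ (smul_mem_twoSidedIdeal _ hk)

theorem parityAut_mem_stdIdeal (B : HomFrame L ι) :
    ∀ a ∈ stdIdeal (dualSubspace (L.map projNegOne)),
    parityAut a ∈ stdIdeal (dualSubspace (L.map projNegOne)) := by
  intro a ha
  obtain ⟨h, rfl⟩ := (B.isGeneratedBy.mem_iff a).1 ha
  rw [map_sum]
  refine sum_mem fun k _ => ?_
  rw [map_mul, (B.isParam_coord k).parity_apply]
  exact TwoSidedIdeal.mul_mem_right _ _ _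
    (smul_mem_twoSidedIdeal _ (TwoSidedIdeal.subset_span (B.coord_mem k)))

/-- The projection along the `t i`, with kernel generated by them. -/
theorem exists_projection : ∃ E : Lam m n →ₐ[ℂ] Lam m n, IsGradedLocal (fil m n) parityAut E ∧
    (∀ k, E (gen k) = B.coord k) ∧ (∀ i f, (B.v i).1 (E f) = 0) ∧
    ∀ f ∈ fil m n 1, E f ∈ stdIdeal (dualSubspace (L.map projNegOne)) := by
  obtain ⟨E, hE, hg⟩ := B.toFrame.exists_projection isCompleteFiltration_fil parityAut_mem_fil
    parityAut_smul (univ : Finset ι).toList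
  have hg' : ∀ k, E (gen k) = B.coord k := fun k => by
    rw [hg _ fun i => ⟨_, constDer_gen _ k⟩, Finset.sum_map_toList, coord]
    congr 1
    refine sum_congr rfl fun i _ => ?_
    change B.t i * (constDer (coeffs (B.X i))).1 (gen k) = _
    rw [constDer_gen, ← Algebra.commutes, ← Algebra.smul_def]
  refine ⟨E, hE, hg', fun i f => ?_, fun f hf => ?_⟩
  · refine IsDer.comp_eq_zero isCompleteFiltration_fil exists_adjoin_sub_mem
      (IsSuperDer.isDer (B.v_mem i)) hE ?_ f
    rintro _ ⟨k, rfl⟩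
    rw [hg', v_coord]
  · let S : Submodule ℂ (Lam m n) :=
      { carrier := {f | E f ∈ stdIdeal (dualSubspace (L.map projNegOne))}
        add_mem' := fun ha hb => by
          rw [Set.mem_ofPred_eq, map_add]; exact TwoSidedIdeal.add_mem _ ha hb
        zero_mem' := by rw [Set.mem_ofPred_eq, map_zero]; exact TwoSidedIdeal.zero_mem _
        smul_mem' := fun c f hf => by
          rw [Set.mem_ofPred_eq, map_smul]; exact smul_mem_twoSidedIdeal _ hf }
    refine mem_augIdeal_of_closed (S := S) (fun k => ?_) (fun a b hb => ?_) (fun a ha b => ?_)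
      (mem_fil_one.1 hf)
    · change E (gen k) ∈ stdIdeal (dualSubspace (L.map projNegOne))
      rw [hg']
      exact TwoSidedIdeal.subset_span (B.coord_mem k)
    · change E (a * b) ∈ stdIdeal (dualSubspace (L.map projNegOne))
      rw [map_mul]
      exact TwoSidedIdeal.mul_mem_left _ _ _ hb
    · change E (a * b) ∈ stdIdeal (dualSubspace (L.map projNegOne))
      rw [map_mul]
      exact TwoSidedIdeal.mul_mem_right _ _ _ ha

end HomFrame

/-- The largest `L`-invariant subspace of the maximal ideal: the elements whose images under all
words in `L` vanish at the origin. -/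
def wordKernel (L : Submodule ℂ (W m n)) : Set (Lam m n) :=
  {f | ∀ k : ℕ, ∀ T ∈ oneSup (homPart L) ^ k, constTerm (T • f) = 0}

theorem wordKernel_le_fil {L : Submodule ℂ (W m n)} {f : Lam m n} (hf : f ∈ wordKernel L) :
    f ∈ fil m n 1 := by
  refine mem_fil_one_iff.2 ?_
  have := hf 0 1 (by rw [pow_zero]; exact Submodule.mem_one.2 ⟨1, map_one _⟩)
  rwa [one_smul] at this

theorem wordKernel_invariant {L : Submodule ℂ (W m n)} (hL : IsSubalgebra L) {X : W m n}
    (hX : X ∈ L) {f : Lam m n} (hf : f ∈ wordKernel L) : X.1 f ∈ wordKernel L := by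
  intro k T hT
  obtain ⟨X₀, h₀, X₁, h₁, h₀', h₁', rfl⟩ := hL.graded X hX
  have e : T • (X₀ + X₁).1 f = (T * X₀.1) • f + (T * X₁.1) • f := by
    rw [mul_smul, mul_smul, ← smul_add]
    rfl
  rw [e, map_add, hf _ _ (mul_mem_oneSup_pow hT (le_oneSup 0 (mem_homPart h₀ h₀'))),
    hf _ _ (mul_mem_oneSup_pow hT (le_oneSup 1 (mem_homPart h₁ h₁'))), add_zero]

/-- A word of length `k` lowers the filtration by at most `k`, so its value at the origin depends
only on `f` modulo step `k + 1`. -/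
theorem isClosed_wordKernel (L : Submodule ℂ (W m n)) : IsClosed (wordKernel L) := by
  rw [← isOpen_compl_iff]
  intro f hf
  simp only [Set.mem_compl_iff, wordKernel, Set.mem_ofPred_eq, not_forall] at hf
  obtain ⟨k, T, hT, h⟩ := hf
  refine ⟨1 + k, fun g hg hg' => h ?_⟩
  have h1 := oneSup_pow_lowers (Lp := homPart L) (F := fil m n) isCompleteFiltration_fil.anti
    (fun p X hX j a ha => (IsSuperDer.isDer hX.2).lowers j a ha) k T hT 1 _ hg
  rw [smul_sub, mem_fil_one_iff, map_sub, hg' k T hT, zero_sub, neg_eq_zero] at h1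
  exact h1

/-- Straightening of a subalgebra: an automorphism which maps the largest `L`-invariant ideal of
the maximal ideal onto the ideal generated by `V*`. -/
theorem exists_straightening {L : Submodule ℂ (W m n)} (hL : IsSubalgebra L) :
    ∃ φ : ContAut m n,
      (∀ f, φ.toAlgEquiv f ∈ stdIdeal (dualSubspace (L.map projNegOne)) ↔ f ∈ wordKernel L) ∧
      (∀ K : Set (Lam m n), (∀ f ∈ K, f ∈ fil m n 1) → (∀ X ∈ L, ∀ f ∈ K, X.1 f ∈ K) →
        ∀ f ∈ K, φ.toAlgEquiv f ∈ stdIdeal (dualSubspace (L.map projNegOne))) ∧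
      (∀ f, φ.toAlgEquiv (parityAut f) = parityAut (φ.toAlgEquiv f)) := by
  obtain ⟨r, ⟨B⟩⟩ := exists_homFrame hL
  have hF := isCompleteFiltration_fil (m := m) (n := n)
  obtain ⟨E, hE, hg, hvE, hEI⟩ := B.exists_projection
  obtain ⟨Φ, hΦ, h2, -, hK, hord⟩ := B.toFrame.exists_flow hF parityAut_mem_fil parityAut_smul
    B.isGeneratedBy B.v_mem_stdIdeal hE hvE (univ : Finset _).toList (nodup_toList _)
  -- To first order `Φ` sends an indeterminate to `coord k + ∑ coeffs (X i) k • t i`, and the sum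
  -- restores exactly what `E` removed.
  have hu : ∀ k, Φ (gen k) - gen k ∈ fil m n 2 := fun k => by
    have h3 := h2 (gen k)
    rw [Finset.sum_map_toList, hg] at h3
    have h4 : ∀ i, B.t i * E ((B.X i).1 (gen k)) - coeffs (B.X i) k • B.t i ∈ fil m n 2 := by
      intro i
      have := hF.mul_mem (B.toFrame.param i).mem
        (hE.map_mem 1 _ (sub_constTerm_mem ((B.X i).1 (gen k))))
      rw [map_sub, AlgHom.commutes, mul_sub, ← Algebra.commutes, ← Algebra.smul_def] at this
      exact this
    have h5 := Submodule.sum_mem (fil m n 2) fun i (_ : i ∈ univ) => h4 i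
    rw [sum_sub_distrib] at h5
    have := add_mem h3 h5
    rw [HomFrame.coord] at this
    convert this using 1
    change _ = Φ (gen k) - (gen k - ∑ i, coeffs (B.X i) k • B.t i +
      ∑ i, B.t i * E ((B.X i).1 (gen k))) + _
    abel
  obtain ⟨φ, hφ⟩ := exists_contAut hΦ hu
  have hKΦ : ∀ K : Set (Lam m n), (∀ f ∈ K, f ∈ fil m n 1) → (∀ X ∈ L, ∀ f ∈ K, X.1 f ∈ K) →
      ∀ f ∈ K, Φ f ∈ stdIdeal (dualSubspace (L.map projNegOne)) := fun K h1 hX =>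
    hK K (fun i f hf => hX _ (B.mem i) f hf) fun f hf => hEI f (h1 f hf)
  refine ⟨φ, fun f => ?_, fun K h1 hX f hf => ?_, fun f => ?_⟩
  · rw [hφ]
    constructor
    · intro hf
      -- `E` fixes constants and preserves the maximal ideal, which contains `I`; so `E g` and `g`
      -- have the same constant term.
      have hE0 : ∀ g, E g ∈ stdIdeal (dualSubspace (L.map projNegOne)) → constTerm g = 0 := by
        intro g hg
        have h3 := sub_mem (stdIdeal_le_fil hg) (hE.map_mem 1 _ (sub_constTerm_mem g))
        rwa [map_sub, AlgHom.commutes, sub_sub_cancel, mem_fil_one_iff, constTerm_algebraMap] at h3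
      refine OrdVanish.all_words (isBracketClosed_homPart hL)
        (fun i => mem_homPart (B.mem i) (B.hom i)) constTerm ?_ (fun i => by simp)
        ((hord f hf).imp hE0)
      rintro p _ ⟨⟨Z, hZ, rfl⟩, hZp⟩
      -- The combination of the `X i` with the same projection as `Z`; the difference `Z₀` is then
      -- an isotropy element of `L`.
      let Y : W m n := ∑ i, (∑ k, B.τ i k * coeffs Z k) • B.X i
      have hYL : Y ∈ L := Submodule.sum_mem _ fun i _ => Submodule.smul_mem _ _ (B.mem i)
      have hYp : Y.1 ∈ superDer m n p := by
        change (↑(∑ i, _ • B.X i : W m n) : Module.End ℂ (Lam m n)) ∈ _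
        rw [AddSubmonoidClass.coe_finsetSum]
        refine Submodule.sum_mem _ fun i _ => ?_
        by_cases h : B.par i = p
        · exact Submodule.smul_mem _ _ (h ▸ B.hom i)
        · have : ∑ k, B.τ i k * coeffs Z k = 0 := sum_eq_zero fun k _ => by
            by_cases hk : genParity k = B.par i
            · rw [coeffs_eq_zero hZp (by rwa [hk]), mul_zero]
            · rw [B.τ_eq_zero i k hk, zero_mul]
          rw [this, zero_smul]
          exact zero_mem _
      have hY : coeffs Y = coeffs Z := by
        rw [map_sum, ← B.expand Z hZ]
        exact sum_congr rfl fun i _ => by rw [map_smul, B.expand Z hZ]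
      let Z₀ : W m n := Z + (-1 : ℂ) • Y
      have hc : coeffs Z₀ = 0 := by
        rw [map_add, map_smul, hY, neg_smul, one_smul, add_neg_cancel]
      have hp : Z₀.1 ∈ superDer m n p := add_mem hZp (Submodule.smul_mem _ _ hYp)
      refine ⟨Z₀.1, mem_homPart (L.add_mem hZ (L.smul_mem _ hYL)) hp,
        fun f => mem_fil_one_iff.1 (apply_mem_fil_of_coeffs hp hc f), ?_⟩
      have : Z.1 - Z₀.1 = ∑ i, (∑ k, B.τ i k * coeffs Z k) • (B.X i).1 := by
        have h1 : Z₀.1 = Z.1 - Y.1 := LinearMap.ext fun g => by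
          change Z.1 g + (-1 : ℂ) • Y.1 g = Z.1 g - Y.1 g
          rw [neg_smul, one_smul, sub_eq_add_neg]
        rw [h1, sub_sub_cancel]
        exact AddSubmonoidClass.coe_finsetSum _ _
      change Z.1 - Z₀.1 ∈ _
      rw [this]
      exact Submodule.sum_mem _ fun i _ => Submodule.smul_mem _ _ (Submodule.subset_span ⟨i, rfl⟩)
    · exact hKΦ (wordKernel L) (fun f hf => wordKernel_le_fil hf)
        (fun X hX f hf => wordKernel_invariant hL hX hf) f
  · rw [hφ]
    exact hKΦ K h1 hX f hf
  · rw [hφ, hφ, hΦ.comm]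

theorem parityAut_mem_stdIdeal {L : Submodule ℂ (W m n)} (hL : IsSubalgebra L) :
    ∀ a ∈ stdIdeal (dualSubspace (L.map projNegOne)),
      parityAut a ∈ stdIdeal (dualSubspace (L.map projNegOne)) := by
  obtain ⟨r, ⟨B⟩⟩ := exists_homFrame hL
  exact B.parityAut_mem_stdIdeal

theorem isGradedIdeal_of_parityAut {I : TwoSidedIdeal (Lam m n)}
    (h : ∀ f ∈ I, parityAut f ∈ I) : IsGradedIdeal I := by
  intro f hf
  obtain ⟨f₀, h₀, f₁, h₁, rfl⟩ := exists_even_add_odd f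
  have hσ := h _ hf
  rw [map_add, parityAut_of_mem h₀, parityAut_of_mem h₁, sgn_zero_right, sgn_one_one, one_smul,
    neg_one_smul] at hσ
  have e0 : f₀ = (2⁻¹ : ℂ) • ((f₀ + f₁) + (f₀ + -f₁)) := by
    rw [add_add_add_comm, add_neg_cancel, add_zero, ← two_smul ℂ, smul_smul,
      inv_mul_cancel₀ two_ne_zero, one_smul]
  have h0 : f₀ ∈ I := by
    rw [e0]
    exact smul_mem_twoSidedIdeal _ (TwoSidedIdeal.add_mem _ hf hσ)
  refine ⟨f₀, h0, f₁, ?_, h₀, h₁, rfl⟩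
  have := TwoSidedIdeal.sub_mem _ hf h0
  rwa [add_sub_cancel_left] at this

theorem dualSubspace_eq_bot_iff {L : Submodule ℂ (W m n)} :
    dualSubspace (L.map projNegOne) = ⊥ ↔ IsTransitive L := by
  constructor
  · intro h
    have htop : L.map coeffs = ⊤ := by
      by_contra hne
      -- If `V` is a proper subspace, a nonzero functional annihilating it is a nonzero element of
      -- `V*`.
      obtain ⟨g, hg0, hg⟩ := Submodule.exists_le_ker_of_lt_top _ (lt_top_iff_ne_top.2 hne)
      have hgs : ∀ w, g w = ∑ k, g (Pi.single k 1) * w k := fun w => by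
        conv_lhs => rw [← LinearMap.sum_single_apply (φ := fun _ : Fin m ⊕ Fin n => ℂ) w, map_sum]
        refine sum_congr rfl fun k _ => ?_
        rw [mul_comm, ← smul_eq_mul, ← map_smul]
        congr 1
        ext l
        simp [Pi.single_apply]
      have hmem := (sum_smul_gen_mem_dualSubspace (L := L) fun k => g (Pi.single k 1)).2
        fun X hX => by
          rw [← hgs]
          exact hg ⟨X, hX, rfl⟩
      rw [h, Submodule.mem_bot] at hmem
      refine hg0 (LinearMap.ext fun w => ?_)
      have := constDer_sum_smul_gen (m := m) (n := n) (fun k => g (Pi.single k 1)) w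
      rw [hmem, map_zero, ← hgs] at this
      exact algebraMap_lam_eq_zero this.symm
    refine le_antisymm ?_ (Submodule.span_le.2 ?_)
    · rintro _ ⟨X, _, rfl⟩
      rw [projNegOne_eq, constDer, degNegOne]
      exact Submodule.sum_mem _ fun k _ => Submodule.smul_mem _ _ (Submodule.subset_span ⟨k, rfl⟩)
    · rintro _ ⟨k, rfl⟩
      obtain ⟨X, hX, he⟩ : (Pi.single k 1 : Fin m ⊕ Fin n → ℂ) ∈ L.map coeffs := htop ▸ trivial
      refine ⟨X, hX, ?_⟩
      rw [projNegOne_eq, he, constDer, sum_eq_single k]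
      · rw [Pi.single_eq_same, one_smul]
      · intro l _ hl
        rw [Pi.single_eq_of_ne hl, zero_smul]
      · exact fun h => absurd (mem_univ k) h
  · intro h
    rw [IsTransitive] at h
    rw [h, eq_bot_iff]
    intro u hu
    obtain ⟨c, rfl⟩ := exists_eq_sum_smul_gen hu.1
    refine (Submodule.mem_bot ℂ).2 (sum_eq_zero fun k _ => ?_)
    have h1 := hu.2 (partialGen k) (Submodule.subset_span ⟨k, rfl⟩)
    rw [map_sum, sum_eq_single k] at h1
    · rw [map_smul, partialGen_gen, if_pos rfl, ← Algebra.algebraMap_eq_smul_one] at h1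
      rw [algebraMap_lam_eq_zero h1, zero_smul]
    · intro l _ hl
      rw [map_smul, partialGen_gen, if_neg hl.symm, smul_zero]
    · exact fun h => absurd (mem_univ k) h

theorem stdIdeal_bot : stdIdeal (⊥ : Submodule ℂ (Lam m n)) = ⊥ := by
  refine le_antisymm (TwoSidedIdeal.span_le.2 ?_) bot_le
  rintro _ rfl
  exact TwoSidedIdeal.zero_mem _

/-- `Λ(m,n)` is local: an element with nonzero constant term, once rescaled, is inverted by a
geometric series. -/
theorem le_fil_of_ne_top {I : TwoSidedIdeal (Lam m n)} (hI : I ≠ ⊤) :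
    ∀ f ∈ I, f ∈ fil m n 1 := by
  intro f hf
  rw [mem_fil_one_iff]
  by_contra hc
  refine hI (TwoSidedIdeal.one_mem_iff _ |>.1 ?_)
  refine one_mem_of_unit isCompleteFiltration_fil (g := 1 - (constTerm f)⁻¹ • f) ?_ ?_
  · have h1 : constTerm (1 : Lam m n) = 1 := by
      rw [← map_one (algebraMap ℂ (Lam m n)), constTerm_algebraMap]
    rw [mem_fil_one_iff, map_sub, map_smul, smul_eq_mul, inv_mul_cancel₀ hc, h1, sub_self]
  · rw [sub_sub_cancel]
    exact smul_mem_twoSidedIdeal _ hf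

end FormalSuper

end

/-! ### The theorem. -/

open FormalSuper in
theorem theorem1p1 (m n : ℕ) (L : Submodule ℂ (W m n)) (hL : IsSubalgebra L)
    (hclosed : IsClosed (L : Set (W m n))) :
    (∃ φ : ContAut m n,
      L.map φ.induced ≤ stdSubalgebra (dualSubspace (L.map projNegOne))) ∧
    ((∀ I : TwoSidedIdeal (Lam m n), IsClosed (I : Set (Lam m n)) → IsInvariant L I →
        I = ⊥ ∨ I = ⊤) ↔ IsTransitive L) ∧
    ((∀ I : TwoSidedIdeal (Lam m n), IsGradedIdeal I → IsClosed (I : Set (Lam m n)) →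
        IsInvariant L I → I = ⊥ ∨ I = ⊤) ↔ IsTransitive L) := by
  obtain ⟨φ, hφ, hK, hσ⟩ := exists_straightening hL
  have hmp : IsTransitive L → ∀ I : TwoSidedIdeal (Lam m n), IsInvariant L I →
      I = ⊥ ∨ I = ⊤ := by
    intro ht I hI
    by_cases htop : I = ⊤
    · exact Or.inr htop
    · left
      rw [← dualSubspace_eq_bot_iff] at ht
      rw [eq_bot_iff]
      intro f hf
      have := hK (I : Set (Lam m n)) (le_fil_of_ne_top htop) hI f hf
      rw [ht, stdIdeal_bot, TwoSidedIdeal.mem_bot] at this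
      rw [TwoSidedIdeal.mem_bot]
      exact (map_eq_zero_iff _ φ.toAlgEquiv.injective).1 this
  -- Only graded ideals are tested, so this one implication serves both equivalences.
  have hmpr : (∀ I : TwoSidedIdeal (Lam m n), IsGradedIdeal I → IsClosed (I : Set (Lam m n)) →
      IsInvariant L I → I = ⊥ ∨ I = ⊤) → IsTransitive L := by
    intro h
    rw [← dualSubspace_eq_bot_iff, eq_bot_iff]
    -- Its description through `stdIdeal` makes `J` a graded ideal; its description as `wordKernel
    -- L` makes it closed and invariant.
    let J : TwoSidedIdeal (Lam m n) :=
      TwoSidedIdeal.comap φ.toAlgEquiv (stdIdeal (dualSubspace (L.map projNegOne)))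
    have hJ : ∀ f, f ∈ J ↔ φ.toAlgEquiv f ∈ stdIdeal (dualSubspace (L.map projNegOne)) :=
      fun f => TwoSidedIdeal.mem_comap _
    have hJw : ∀ f, f ∈ J ↔ f ∈ wordKernel L := fun f => (hJ f).trans (hφ f)
    have hJset : (J : Set (Lam m n)) = wordKernel L := Set.ext hJw
    have hJgr : IsGradedIdeal J := isGradedIdeal_of_parityAut fun f hf => by
      rw [hJ, hσ]
      exact parityAut_mem_stdIdeal hL _ ((hJ f).1 hf)
    have hJcl : IsClosed (J : Set (Lam m n)) := hJset ▸ isClosed_wordKernel L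
    have hJinv : IsInvariant L J := fun X hX f hf => by
      rw [hJw] at hf ⊢
      exact wordKernel_invariant hL hX hf
    rcases h J hJgr hJcl hJinv with h | h
    · intro u hu
      have h1 : φ.toAlgEquiv.symm u ∈ J := by
        rw [hJ, AlgEquiv.apply_symm_apply]
        exact TwoSidedIdeal.subset_span hu
      rw [h, TwoSidedIdeal.mem_bot] at h1
      exact (Submodule.mem_bot ℂ).2 ((map_eq_zero_iff _ φ.toAlgEquiv.symm.injective).1 h1)
    · exfalso
      have h1 : (1 : Lam m n) ∈ J := h ▸ trivial
      have h2 := mem_fil_one_iff.1 (wordKernel_le_fil ((hJw 1).1 h1))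
      rw [← map_one (algebraMap ℂ (Lam m n)), constTerm_algebraMap] at h2
      exact one_ne_zero h2
  refine ⟨⟨φ, ?_⟩, ⟨fun h => hmpr fun I _ => h I, fun h I _ => hmp h I⟩,
    ⟨hmpr, fun h I _ _ => hmp h I⟩⟩
  -- Transported by `φ⁻¹`, the claim becomes the `L`-invariance of `wordKernel L`.
  rintro _ ⟨X, hX, rfl⟩ f hf
  change φ.toAlgEquiv (X.1 (φ.toAlgEquiv.symm f)) ∈ _
  rw [hφ]
  refine wordKernel_invariant hL hX ?_
  rw [← hφ, AlgEquiv.apply_symm_apply]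
  exact hf
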